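/- Let $\beta$ be a Pisot number, i.e. a real algebraic integer $\beta>1$ all of whose other conjugates have modulus $<1$. **Notation.** $T_\beta(x)=\beta x \bmod 1$, and $d_\beta(x)=(u_i)_{i\ge1}$ with $u_i=\lfloor\beta T_\beta^{i-1}(x)\rfloor$. $\Pi_\beta^{(r)}$ is the set of rationals in $[0,1)$ whose $\beta$-expansion is purely periodic. Put $d^*_\beta(1)=d_\beta(1)$ if $d_\beta(1)$ is infinite and $d^*_\beta(1)=(t_1\cdots t_{N-1}t_N)^\infty$ if $d_\beta(1)=t_1\cdots t_{N-1}(t_N+1)0^\infty$; write $d_\beta^*(1)=t_1\cdots t_m(t_{m+1}\cdots t_n)^\infty$ with minimal preperiod and period, and $\mathcal A=\{1,\dots,n\}$. A finite string $w$ is admissible if all shifts of $w0^\infty$ are lexicographically smaller than $d^*_\beta(1)$. The admissibility graph has nodes $\mathcal A$ and edges $a\xrightarrow{\varepsilon}1$ ($0\le\varepsilon<t_a$), $a\xrightarrow{t_a}a+1$ ($a<n$), $n\xrightarrow{t_n}m+1$; $\mathcal L^{(a)}_\beta$ is the set of admissible strings labelling a path from $1$ to $a$. For $y\ge0$, $\{y\}_\beta$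 is the fractional part of $y$ in its $\beta$-expansion. $\mathbb K_\infty\cong\mathbb R^{r-1}\times\mathbb C^s$ is the product of the Archimedean completions of $\mathbb Q(\beta)$ other than the one given by $\mathbb Q(\beta)\subset\mathbb R$; $\mathbb K_f$ is the product of the completions at the prime ideals $\mathfrak P_1,\dots,\mathfrak P_\nu$ of the ring of integers that contain $\beta$; $\mathbb K_\beta=\mathbb K_\infty\times\mathbb K_f$, with embeddings $\phi_\infty,\phi_f,\phi_\beta=(\phi_\infty,\phi_f)$ of $\mathbb Q(\beta)$ and projection $\pi_\infty:\mathbb K_\beta\to\mathbb K_\infty$. For $x\in\mathbb R$, $\Delta_\infty(x)=(x,\dots,x)\in\mathbb K_\infty$, and $\Delta_\infty(E)=\{\Delta_\infty(x):x\in E\}$. $\mathbb Z_{(N(\beta))}$ is the set of rationals $p/q$ with $\gcd(q,N(\beta))=1$, $N(\beta)$ being the norm of $\beta$. Let $Z=\overline{\phi_f(\mathbb Z_{(N(\beta))})}$. The complete tiles are $$\widetilde{\mathcal T}^{(a)}=\overline{\phi_\beta\big(\{w_p\beta^p+\dots+w_0:\ w_p\cdots w_0\in\mathcal L_\beta^{(a)}\}\big)},\qquad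 \widetilde{\mathcal T}(x)=\overline{\phi_\beta(\{y\ge0:\ \{y\}_\beta=x\})}.$$ **Theorem.** Let $(u,v)$ be a non-empty open interval with $(u,v)\cap\mathbb Z_{(N(\beta))}\subset\Pi^{(r)}_\beta$. 1. If $v<1$ and $v\in\mathbb Z_{(N(\beta))}$, then $v\in\Pi_\beta^{(r)}$. If $\phi_f(\mathbb Q)$ is dense in $\mathbb K_f$, the same conclusion holds for $v<1$, $v\in\mathbb Q$ with $v$ integral at each of $\mathfrak P_1,\dots,\mathfrak P_\nu$. 2. If $(u,v)$ is maximal (for inclusion) among such intervals and $v<1$, then at least one of the following holds (they need not exclude each other): - (A) there is $a\in\mathcal A$ with $\Delta_\infty(v)\in\pi_\infty\big(-\widetilde{\mathcal T}^{(a)}\cap(\Delta_\infty(\{T_\beta^{a-1}(1)\})\times Z)\big)$ and $v=T_\beta^{a-1}(1)$; - (B) there are $a,b\in\mathcal A$ with $\Delta_\infty(v)\in\pi_\infty\big(-\widetilde{\mathcal T}^{(a)}\cap-\widetilde{\mathcal T}^{(b)}\cap(\Delta_\infty([T_\beta^{b-1}(1),T_\beta^{a-1}(1)))\times Z)\big)$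 and $T_\beta^{b-1}(1)\le v<T_\beta^{a-1}(1)$; - (C) there are $a\in\mathcal A$ and $x\in\mathbb Z[1/\beta]\cap(0,1)$ with $\Delta_\infty(v)\in\pi_\infty\big(-\widetilde{\mathcal T}^{(a)}\cap-\widetilde{\mathcal T}(x)\cap(\Delta_\infty((0,T_\beta^{a-1}(1)))\times Z)\big)$ and $v<T_\beta^{a-1}(1)$. 3. The statements 1 and 2 hold with $v$ replaced by $u$ and the condition $v<1$ replaced by $u>0$. -/

import Mathlib

open NumberField IsDedekindDomain
open scoped IntermediateField Pointwise

noncomputable section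

namespace BetaNum

/-- A Pisot number: a real algebraic integer `β > 1` all of whose other conjugates have modulus
`< 1`. -/
class IsPisot (β : ℝ) : Prop where
  one_lt : 1 < β
  isIntegral : IsIntegral ℤ β
  norm_lt_one : ∀ z : ℂ, z ∈ (minpoly ℚ β).aroots ℂ → z ≠ (β : ℂ) → ‖z‖ < 1

/-! ### Beta-numeration -/

/-- The `β`-transformation `x ↦ β x mod 1`. -/
def betaT (β x : ℝ) : ℝ := Int.fract (β * x)

/-- The digits of the `β`-expansion of `x ≥ 0`; `digit β x i` is the coefficient of
`β ^ (-(i + 1))`, i.e. the digit usually written `u_{i+1}`. -/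
def digit (β x : ℝ) (i : ℕ) : ℕ := ⌊β * (betaT β)^[i] x⌋₊

/-- The set `Π_β^{(r)}` of rational numbers in `[0,1)` with purely periodic `β`-expansion. -/
def purelyPeriodic (β : ℝ) : Set ℚ :=
  {x | 0 ≤ x ∧ x < 1 ∧ ∃ p : ℕ, 0 < p ∧ ∀ i, digit β x (i + p) = digit β x i}

/-- `d_β(1)` is finite (ends in zeros). -/
def FiniteOne (β : ℝ) : Prop := ∃ N : ℕ, ∀ i, N ≤ i → digit β 1 i = 0

/-- The length of `d_β(1)`, when it is finite. -/
def lengthOne (β : ℝ) : ℕ := sInf {N : ℕ | ∀ i, N ≤ i → digit β 1 i = 0}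

open Classical in
/-- The sequence `d*_β(1) = t_1 t_2 …`, with `t_a = dstar β (a - 1)`: it is `d_β(1)` if that is
infinite, and `(t_1 … t_{N-1} t_N)^∞` if `d_β(1) = t_1 … t_{N-1} (t_N + 1) 0^∞`. -/
def dstar (β : ℝ) (i : ℕ) : ℕ :=
  if FiniteOne β then
    if (i + 1) % lengthOne β = 0 then digit β 1 (lengthOne β - 1) - 1
    else digit β 1 (i % lengthOne β)
  else digit β 1 i

/-- The length `m` of the preperiod of `d*_β(1)`. -/
def preLen (β : ℝ) : ℕ :=
  sInf {m : ℕ | ∃ p : ℕ, 0 < p ∧ ∀ k, m ≤ k → dstar β (k + p) = dstar β k}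

/-- The length of the (minimal) period of `d*_β(1)`. -/
def perLen (β : ℝ) : ℕ :=
  sInf {p : ℕ | 0 < p ∧ ∀ k, preLen β ≤ k → dstar β (k + p) = dstar β k}

/-- The number `n` of nodes, so that `d*_β(1) = t_1 … t_m (t_{m+1} … t_n)^∞`. -/
def numNodes (β : ℝ) : ℕ := preLen β + perLen β

/-- The alphabet `𝒜 = {1, …, n}`. -/
def nodes (β : ℝ) : Set ℕ := Set.Icc 1 (numNodes β)

/-- Strict lexicographical order on sequences. -/
def LexLT (s t : ℕ → ℕ) : Prop := ∃ j, (∀ i < j, s i = t i) ∧ s j < t j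

/-- A finite string is admissible if, completed by zeros, all its shifts are lexicographically
smaller than `d*_β(1)`. -/
def Admissible (β : ℝ) (w : List ℕ) : Prop :=
  ∀ k, LexLT (fun i => w.getD (k + i) 0) (dstar β)

/-- The edges `b --ε--> a` of the admissibility graph. -/
inductive Edge (β : ℝ) : ℕ → ℕ → ℕ → Prop
  | reset {b ε : ℕ} (hb : b ∈ nodes β) (hε : ε < dstar β (b - 1)) : Edge β b ε 1
  | next {b : ℕ} (hb : b ∈ nodes β) (hn : b < numNodes β) :
      Edge β b (dstar β (b - 1)) (b + 1)
  | loop : Edge β (numNodes β) (dstar β (numNodes β - 1)) (preLen β + 1)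

/-- `Conducts β w a`: the string `w`, read from left to right, labels a path of the admissibility
graph from the initial node `1` to the node `a`. -/
inductive Conducts (β : ℝ) : List ℕ → ℕ → Prop
  | nil : Conducts β [] 1
  | snoc {w : List ℕ} {b ε a : ℕ} (hw : Conducts β w b) (he : Edge β b ε a) :
      Conducts β (w ++ [ε]) a

/-- The language `ℒ_β^{(a)}`. -/
def lang (β : ℝ) (a : ℕ) : Set (List ℕ) := {w | Admissible β w ∧ Conducts β w a}

/-- The fractional part `{y}_β` of a real `y ≥ 0`: if `β ^ (-p) y ∈ [0,1)`, the first `p` digits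
of `β ^ (-p) y` form the integer part of `y`, and the remaining ones its fractional part. -/
def fracPart (β y : ℝ) : ℝ :=
  let p := sInf {p : ℕ | y / β ^ p < 1}
  (betaT β)^[p] (y / β ^ p)

/-! ### The representation space -/

instance numberField (β : ℝ) [h : IsPisot β] : NumberField ℚ⟮β⟯ where
  to_charZero := inferInstance
  to_finiteDimensional := IntermediateField.adjoin.finiteDimensional h.isIntegral.tower_top

/-- `β` as an element of `ℚ(β)`. -/
def gen (β : ℝ) : ℚ⟮β⟯ := IntermediateField.AdjoinSimple.gen ℚ β

theorem gen_isIntegral (β : ℝ) [h : IsPisot β] : IsIntegral ℤ (gen β) := by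
  have h1 : IsIntegral ℤ (algebraMap ℚ⟮β⟯ ℝ (gen β)) := by
    simpa [gen] using h.isIntegral
  exact (isIntegral_algebraMap_iff (algebraMap ℚ⟮β⟯ ℝ).injective).1 h1

/-- `β` as an element of the ring of integers of `ℚ(β)`. -/
def genInt (β : ℝ) [IsPisot β] : 𝓞 ℚ⟮β⟯ := ⟨gen β, gen_isIntegral β⟩

/-- The Archimedean place of `ℚ(β)` given by the inclusion `ℚ(β) ⊆ ℝ`. -/
def stdPlace (β : ℝ) : InfinitePlace ℚ⟮β⟯ :=
  InfinitePlace.mk (Complex.ofRealHom.comp (algebraMap ℚ⟮β⟯ ℝ))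

/-- The Euclidean representation space `𝕂_∞ = ℝ^(r-1) × ℂ^s`: one real, resp. complex, factor for
every real, resp. complex, place other than the standard one. -/
abbrev KInf (β : ℝ) : Type :=
  ({w : InfinitePlace ℚ⟮β⟯ // w.IsReal ∧ w ≠ stdPlace β} → ℝ) ×
    ({w : InfinitePlace ℚ⟮β⟯ // w.IsComplex} → ℂ)

/-- The embedding `φ_∞`. -/
def phiInf (β : ℝ) (x : ℚ⟮β⟯) : KInf β :=
  (fun w => InfinitePlace.embedding_of_isReal w.2.1 x, fun w => w.1.embedding x)

/-- The prime ideals of the ring of integers of `ℚ(β)` that contain `β`. -/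
abbrev Primes (β : ℝ) [IsPisot β] : Type :=
  {P : HeightOneSpectrum (𝓞 ℚ⟮β⟯) // genInt β ∈ P.asIdeal}

/-- The product `𝕂_f` of the completions at the primes containing `β`. -/
abbrev KFin (β : ℝ) [IsPisot β] : Type :=
  (P : Primes β) → P.1.adicCompletion ℚ⟮β⟯

/-- The embedding `φ_f`. -/
def phiFin (β : ℝ) [IsPisot β] (x : ℚ⟮β⟯) : KFin β :=
  fun P => algebraMap ℚ⟮β⟯ (P.1.adicCompletion ℚ⟮β⟯) x

/-- The complete representation space `𝕂_β = 𝕂_∞ × 𝕂_f`. -/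
abbrev KBeta (β : ℝ) [IsPisot β] : Type := KInf β × KFin β

/-- The embedding `φ_β`. -/
def phiBeta (β : ℝ) [IsPisot β] (x : ℚ⟮β⟯) : KBeta β := (phiInf β x, phiFin β x)

/-- The projection `π_∞`. -/
def piInf (β : ℝ) [IsPisot β] (z : KBeta β) : KInf β := z.1

/-- The diagonal point `Δ_∞(x) = (x, …, x)`. -/
def diag (β : ℝ) (x : ℝ) : KInf β := (fun _ => x, fun _ => (x : ℂ))

/-- The set `ℤ_(N(β))` of rationals with denominator coprime to the norm of `β`. -/
def ZN (β : ℝ) [IsPisot β] : Set ℚ :=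
  {q | Nat.Coprime q.den (Algebra.norm ℤ (genInt β)).natAbs}

/-- The closure of `φ_f(ℤ_(N(β)))` in `𝕂_f`. -/
def closZN (β : ℝ) [IsPisot β] : Set (KFin β) :=
  closure ((fun q : ℚ => phiFin β (q : ℚ⟮β⟯)) '' ZN β)

/-! ### Complete tiles -/

/-- The complete central subtile `T̃^{(a)}`: the closure of the image by `φ_β` of the
`β`-integers `w_p β ^ p + ⋯ + w_0` whose expansion `w_p … w_0` belongs to `ℒ_β^{(a)}`. -/
def subtile (β : ℝ) [IsPisot β] (a : ℕ) : Set (KBeta β) :=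
  closure (phiBeta β '' {x | ∃ w ∈ lang β a, x = Nat.ofDigits (gen β) w.reverse})

/-- The complete `x`-tile `T̃(x)`. -/
def tile (β : ℝ) [IsPisot β] (x : ℚ⟮β⟯) : Set (KBeta β) :=
  closure (phiBeta β '' {y | 0 ≤ (y : ℝ) ∧ fracPart β (y : ℝ) = (x : ℝ)})

/-- The set `ℤ[1/β] ∩ (0,1)`. -/
def fracIndex (β : ℝ) : Set ℚ⟮β⟯ :=
  {x | x ∈ Algebra.adjoin ℤ {(gen β)⁻¹} ∧ 0 < (x : ℝ) ∧ (x : ℝ) < 1}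

/-! ### Intervals of purely periodic rationals -/

/-- `(u, v)` is a non-empty open interval with `(u, v) ∩ ℤ_(N(β)) ⊆ Π_β^{(r)}`. -/
def GoodInterval (β : ℝ) [IsPisot β] (u v : ℝ) : Prop :=
  u < v ∧ ∀ q : ℚ, q ∈ ZN β → (q : ℝ) ∈ Set.Ioo u v → q ∈ purelyPeriodic β

/-- `(u, v)` is a maximal interval with the previous property. -/
def MaximalInterval (β : ℝ) [IsPisot β] (u v : ℝ) : Prop :=
  GoodInterval β u v ∧
    ∀ u' v' : ℝ, Set.Ioo u v ⊆ Set.Ioo u' v' → GoodInterval β u' v' →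
      Set.Ioo u' v' = Set.Ioo u v

/-- Case (A) for the endpoint `e`. -/
def CaseA (β : ℝ) [IsPisot β] (e : ℝ) : Prop :=
  ∃ a ∈ nodes β,
    diag β e ∈ piInf β ''
      (-subtile β a ∩ ((diag β '' {(betaT β)^[a - 1] 1}) ×ˢ closZN β)) ∧
    e = (betaT β)^[a - 1] 1

/-- Case (B) for the endpoint `e`. -/
def CaseB (β : ℝ) [IsPisot β] (e : ℝ) : Prop :=
  ∃ a ∈ nodes β, ∃ b ∈ nodes β,
    diag β e ∈ piInf β ''
      (-subtile β a ∩ -subtile β b ∩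
        ((diag β '' Set.Ico ((betaT β)^[b - 1] 1) ((betaT β)^[a - 1] 1)) ×ˢ closZN β)) ∧
    (betaT β)^[b - 1] 1 ≤ e ∧ e < (betaT β)^[a - 1] 1

/-- Case (C) for the endpoint `e`. -/
def CaseC (β : ℝ) [IsPisot β] (e : ℝ) : Prop :=
  ∃ a ∈ nodes β, ∃ x ∈ fracIndex β,
    diag β e ∈ piInf β ''
      (-subtile β a ∩ -tile β x ∩
        ((diag β '' Set.Ioo 0 ((betaT β)^[a - 1] 1)) ×ˢ closZN β)) ∧
    e < (betaT β)^[a - 1] 1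

/-- The density condition: `φ_f(ℚ)` is dense in `𝕂_f`. -/
def DensityCondition (β : ℝ) [IsPisot β] : Prop :=
  Dense (Set.range fun q : ℚ => phiFin β (q : ℚ⟮β⟯))

/-- The rational number `q` is integral at all primes containing `β`, that is,
`q ∈ 𝔒_(β) ∩ ℚ`. -/
def IntegralAtBeta (β : ℝ) [IsPisot β] (q : ℚ) : Prop :=
  ∀ P : Primes β, P.1.valuation ℚ⟮β⟯ (q : ℚ⟮β⟯) ≤ 1

end BetaNum

end

namespace BetaNum

open Filter Topology

variable {β : ℝ}

/-! ### The dynamics of the `β`-transformation -/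

/-! The proof rests on a description of pure periodicity by tiles: a rational `q ≥ 0` is purely
periodic exactly when `-φ_β(q)` lies in a central subtile `T̃^(a)` with `q < T^(a-1)(1)`. If `T^p(q)
= q`, then the numbers `q (β^(pk) - 1)` are `β`-integers, and they tend to `-φ_β(q)` because `β` is
contracting on `𝕂_β` (`exists_subtile_of_purelyPeriodic`). Conversely, a `β`-integer `y` close to
`-φ_β(q)` yields an orbit that ends at `q` and whose last iterates, having bounded denominator and
bounded conjugates, lie in a finite set; a coincidence among them makes `q` periodic
(`purelyPeriodic_of_mem_subtile`).

Let `e` be an endpoint, strictly between 0 and 1. Elements of `ℤ_(N(β))` in the interval approximate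
every `(e, z)` with `z ∈ Z`, since adding multiples of `N(β)^k` moves the real coordinate and hardly
moves the finite ones. Subtiles are closed and nodes finite in number, so each `(Δ_∞(e), z)` lies in
some `-T̃^(a)` with `e ≤ T^(a-1)(1)` (`exists_subtile_of_accumulation`). If `e` is itself in
`ℤ_(N(β))`, take `z = φ_f(e)`: equality is impossible because `T^(a-1)(1)` is an algebraic integer,
so `e` is purely periodic. If the interval is maximal, rationals of `ℤ_(N(β))` that are not purely
periodic accumulate at `e`. Each lies in some `-T̃^(b)` with `T^(b-1)(1) ≤ q`, or in one of finitely
many `-T̃(x)` (`exists_finite_tiles`). Compactness of `Z` provides a limit `z`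
(`exists_tile_of_accumulation`), and comparing both descriptions at `(Δ_∞(e), z)` gives (A), (B) or
(C). -/

theorem betaT_nonneg (x : ℝ) : 0 ≤ betaT β x := Int.fract_nonneg _

theorem betaT_lt_one (x : ℝ) : betaT β x < 1 := Int.fract_lt_one _

theorem iterate_betaT_nonneg {x : ℝ} (hx : 0 ≤ x) (i : ℕ) : 0 ≤ (betaT β)^[i] x := by
  cases i with
  | zero => simpa
  | succ i => rw [Function.iterate_succ_apply']; exact betaT_nonneg _

theorem iterate_betaT_lt_one {x : ℝ} (hx : x < 1) (i : ℕ) : (betaT β)^[i] x < 1 := by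
  cases i with
  | zero => simpa
  | succ i => rw [Function.iterate_succ_apply']; exact betaT_lt_one _

theorem iterate_betaT_le_one {x : ℝ} (hx : x ≤ 1) (i : ℕ) : (betaT β)^[i] x ≤ 1 := by
  cases i with
  | zero => simpa
  | succ i => rw [Function.iterate_succ_apply']; exact (betaT_lt_one _).le

theorem digit_add (x : ℝ) (k i : ℕ) : digit β x (k + i) = digit β ((betaT β)^[k] x) i := by
  rw [digit, digit, ← Function.iterate_add_apply, add_comm]

theorem pisot_pos [h : IsPisot β] : 0 < β := one_pos.trans h.one_lt

theorem mul_eq_floor_add_betaT [IsPisot β] {x : ℝ} (hx : 0 ≤ x) :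
    β * x = (⌊β * x⌋₊ : ℝ) + betaT β x := by
  have h : 0 ≤ β * x := mul_nonneg pisot_pos.le hx
  rw [betaT, natCast_floor_eq_intCast_floor h, Int.floor_add_fract]

theorem mul_iterate_betaT [IsPisot β] {x : ℝ} (hx : 0 ≤ x) (i : ℕ) :
    β * (betaT β)^[i] x = digit β x i + (betaT β)^[i + 1] x := by
  rw [Function.iterate_succ_apply']
  exact mul_eq_floor_add_betaT (iterate_betaT_nonneg hx i)

theorem digit_le [IsPisot β] {x : ℝ} (h0 : 0 ≤ x) (hx : x ≤ 1) (i : ℕ) : (digit β x i : ℝ) ≤ β := by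
  have h1 := mul_iterate_betaT (β := β) h0 i
  have h2 := iterate_betaT_nonneg (β := β) h0 (i + 1)
  have h3 := iterate_betaT_le_one (β := β) hx i
  have h4 : β * (betaT β)^[i] x ≤ β * 1 := mul_le_mul_of_nonneg_left h3 pisot_pos.le
  linarith

/-- Two bounded sequences whose difference is expanded by `β` at each step agree initially. -/
theorem eq_of_bounded_expanding [h : IsPisot β] {f g : ℕ → ℝ} (hf : ∀ i, f i ∈ Set.Icc (0 : ℝ) 1)
    (hg : ∀ i, g i ∈ Set.Icc (0 : ℝ) 1) (hfg : ∀ i, f (i + 1) - g (i + 1) = β * (f i - g i)) :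
    f 0 = g 0 := by
  have key : ∀ n, f n - g n = β ^ n * (f 0 - g 0) := by
    intro n
    induction n with
    | zero => simp
    | succ n ih => rw [hfg, ih]; ring
  by_contra hne
  have hpos : 0 < |f 0 - g 0| := abs_pos.2 (sub_ne_zero.2 hne)
  obtain ⟨n, hn⟩ := pow_unbounded_of_one_lt (1 / |f 0 - g 0|) h.one_lt
  rw [div_lt_iff₀ hpos] at hn
  have h1 : |f n - g n| = β ^ n * |f 0 - g 0| := by
    rw [key, abs_mul, abs_of_pos (pow_pos pisot_pos n)]
  have h2 : |f n - g n| ≤ 1 := by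
    rw [abs_le]
    constructor <;> linarith [(hf n).1, (hf n).2, (hg n).1, (hg n).2]
  linarith

theorem eq_of_digit_eq [IsPisot β] {x y : ℝ} (hx : x ∈ Set.Icc (0 : ℝ) 1)
    (hy : y ∈ Set.Icc (0 : ℝ) 1) (h : ∀ i, digit β x i = digit β y i) : x = y := by
  refine eq_of_bounded_expanding (β := β) (f := fun i => (betaT β)^[i] x)
    (g := fun i => (betaT β)^[i] y)
    (fun i => ⟨iterate_betaT_nonneg hx.1 i, iterate_betaT_le_one hx.2 i⟩)
    (fun i => ⟨iterate_betaT_nonneg hy.1 i, iterate_betaT_le_one hy.2 i⟩) fun i => ?_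
  have h1 := mul_iterate_betaT (β := β) hx.1 i
  have h2 := mul_iterate_betaT (β := β) hy.1 i
  rw [h i] at h1
  linarith

/-- Digits determine the point, so a period of the digit sequence is a period of the orbit. The
proofs below work with orbits only. -/
theorem mem_purelyPeriodic_iff [IsPisot β] {q : ℚ} :
    q ∈ purelyPeriodic β ↔ 0 ≤ q ∧ q < 1 ∧ ∃ p, 0 < p ∧ (betaT β)^[p] (q : ℝ) = q := by
  refine and_congr_right fun h0 => and_congr_right fun h1 => exists_congr fun p =>
    and_congr_right fun _ => ?_
  have h0' : (0 : ℝ) ≤ q := by exact_mod_cast h0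
  have h1' : (q : ℝ) ≤ 1 := by exact_mod_cast h1.le
  constructor
  · intro h
    refine eq_of_digit_eq (β := β) ⟨iterate_betaT_nonneg h0' p, iterate_betaT_le_one h1' p⟩ ⟨h0', h1'⟩ ?_
    intro i
    rw [← digit_add, add_comm, h]
  · intro h i
    rw [add_comm, digit_add, h]

theorem iterate_mul_betaT {x : ℝ} {p : ℕ} (h : (betaT β)^[p] x = x) (k : ℕ) :
    (betaT β)^[p * k] x = x := by
  rw [Function.iterate_mul]
  exact Function.iterate_fixed h k

/-! ### Conjugates of `β` and finiteness -/

variable (β) in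
/-- The inclusion of `ℚ(β)` into `ℂ`. -/
noncomputable def stdEmb : ℚ⟮β⟯ →+* ℂ := Complex.ofRealHom.comp (algebraMap ℚ⟮β⟯ ℝ)

theorem stdEmb_apply (x : ℚ⟮β⟯) : stdEmb β x = ((x : ℝ) : ℂ) := rfl

theorem coe_gen : ((gen β : ℚ⟮β⟯) : ℝ) = β := rfl

theorem norm_conj_gen_lt_one [h : IsPisot β] {σ : ℚ⟮β⟯ →+* ℂ} (hσ : σ ≠ stdEmb β) :
    ‖σ (gen β)‖ < 1 := by
  have hint : IsIntegral ℚ β := h.isIntegral.tower_top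
  refine h.norm_lt_one _ ?_ ?_
  · rw [Polynomial.mem_aroots]
    refine ⟨minpoly.ne_zero hint, ?_⟩
    have h1 : Polynomial.aeval (gen β) (minpoly ℚ β) = 0 := by
      rw [gen, ← IntermediateField.minpoly_gen]
      exact minpoly.aeval _ _
    have h2 := Polynomial.aeval_algHom_apply σ.toRatAlgHom (gen β) (minpoly ℚ β)
    rw [h1, map_zero] at h2
    exact h2
  · intro he
    apply hσ
    have : σ.toRatAlgHom = (stdEmb β).toRatAlgHom := by
      refine IntermediateField.algHom_ext_of_eq_adjoin _ (s := {β}) rfl ?_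
      rintro x rfl
      exact he
    ext x
    exact DFunLike.congr_fun this x

-- Taking `C` at least `β / (1 - |σ(β)|)` for all the other embeddings makes the disc of radius `C`
-- stable under `z ↦ σ(β) z ± ε` for every digit `ε ≤ β`. Every bound on conjugates below comes from
-- this.
variable (β) in
theorem exists_conj_bound [h : IsPisot β] :
    ∃ C : ℝ, 0 ≤ C ∧ ∀ σ : ℚ⟮β⟯ →+* ℂ, σ ≠ stdEmb β → β + ‖σ (gen β)‖ * C ≤ C := by
  obtain ⟨C, hC⟩ := (Set.finite_range fun σ : ℚ⟮β⟯ →+* ℂ => β / (1 - ‖σ (gen β)‖)).bddAbove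
  refine ⟨max C 0, le_max_right _ _, fun σ hσ => ?_⟩
  have h1 : β / (1 - ‖σ (gen β)‖) ≤ max C 0 := (hC ⟨σ, rfl⟩).trans (le_max_left _ _)
  have h2 : 0 < 1 - ‖σ (gen β)‖ := sub_pos.2 (norm_conj_gen_lt_one hσ)
  rw [div_le_iff₀ h2] at h1
  linarith

-- Clearing the denominator `d` reduces this to the finiteness of algebraic integers of a number
-- field with all conjugates bounded.
variable (β) in
theorem finite_bounded_conj [IsPisot β] (d : ℕ) (hd : d ≠ 0) (B : ℝ) :
    {x : ℚ⟮β⟯ | IsIntegral ℤ ((d : ℚ⟮β⟯) * x) ∧ |(x : ℝ)| ≤ B ∧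
      ∀ σ : ℚ⟮β⟯ →+* ℂ, σ ≠ stdEmb β → ‖σ x‖ ≤ B}.Finite := by
  have hd' : (d : ℚ⟮β⟯) ≠ 0 := Nat.cast_ne_zero.2 hd
  refine Set.Finite.of_finite_image ((Embeddings.finite_of_norm_le ℚ⟮β⟯ ℂ (d * B)).subset ?_)
    (f := fun x => (d : ℚ⟮β⟯) * x) (fun x _ y _ hxy => mul_left_cancel₀ hd' hxy)
  rintro _ ⟨x, ⟨h1, h2, h3⟩, rfl⟩
  refine ⟨h1, fun σ => ?_⟩
  rw [map_mul, map_natCast, norm_mul, Complex.norm_natCast]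
  refine mul_le_mul_of_nonneg_left ?_ (Nat.cast_nonneg _)
  by_cases hσ : σ = stdEmb β
  · rw [hσ, stdEmb_apply, Complex.norm_real, Real.norm_eq_abs]
    exact h2
  · exact h3 σ hσ

theorem isIntegral_of_mem_adjoin [IsPisot β] {x : ℚ⟮β⟯} (hx : x ∈ Algebra.adjoin ℤ {gen β}) :
    IsIntegral ℤ x :=
  adjoin_le_integralClosure (gen_isIntegral β) hx

/-- The orbit of 1 stays in `ℤ[β]` with bounded conjugates, hence in a finite set. This makes
`d*_β(1)` eventually periodic and the graph finite. -/
theorem exists_iterate_one_eq [IsPisot β] :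
    ∃ i p : ℕ, 0 < p ∧ (betaT β)^[i + p] 1 = (betaT β)^[i] 1 := by
  obtain ⟨C, hC0, hC⟩ := exists_conj_bound β
  have key : ∀ k : ℕ, ∃ g : ℚ⟮β⟯, (g : ℝ) = (betaT β)^[k] 1 ∧
      g ∈ Algebra.adjoin ℤ {gen β} ∧ ∀ σ : ℚ⟮β⟯ →+* ℂ, σ ≠ stdEmb β → ‖σ g‖ ≤ 1 + C := by
    intro k
    induction k with
    | zero => exact ⟨1, by simp, one_mem _, fun σ _ => by simpa using hC0⟩
    | succ k ih =>
      obtain ⟨g, hg, hg1, hg2⟩ := ih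
      refine ⟨gen β * g - (digit β 1 k : ℚ⟮β⟯), ?_, ?_, fun σ hσ => ?_⟩
      · have := mul_iterate_betaT (β := β) zero_le_one k
        push_cast
        rw [hg, coe_gen]
        linarith
      · exact sub_mem (mul_mem (Algebra.self_mem_adjoin_singleton _ _) hg1) (natCast_mem _ _)
      · have h1 := hg2 σ hσ
        have h2 := hC σ hσ
        have h3 := (norm_conj_gen_lt_one hσ).le
        have h4 : (digit β 1 k : ℝ) ≤ β := digit_le zero_le_one le_rfl k
        have h5 := norm_sub_le (σ (gen β) * σ g) (digit β 1 k : ℂ)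
        rw [norm_mul, Complex.norm_natCast] at h5
        rw [map_sub, map_mul, map_natCast]
        have h6 := mul_le_mul_of_nonneg_left h1 (norm_nonneg (σ (gen β)))
        linarith
  choose g hg hg1 hg2 using key
  obtain ⟨i, -, j, -, hij, he⟩ := Set.infinite_univ.exists_ne_map_eq_of_mapsTo (f := g)
    (fun k _ => by
      refine (⟨?_, ?_, fun σ hσ => hg2 k σ hσ⟩ : g k ∈ {x : ℚ⟮β⟯ | IsIntegral ℤ (((1 : ℕ) : ℚ⟮β⟯) * x)
        ∧ |(x : ℝ)| ≤ 1 + C ∧ ∀ σ : ℚ⟮β⟯ →+* ℂ, σ ≠ stdEmb β → ‖σ x‖ ≤ 1 + C})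
      · simpa using isIntegral_of_mem_adjoin (hg1 k)
      · rw [hg, abs_of_nonneg (iterate_betaT_nonneg zero_le_one k)]
        linarith [iterate_betaT_le_one (β := β) le_rfl k])
    (finite_bounded_conj β 1 one_ne_zero (1 + C))
  have he' : (betaT β)^[i] 1 = (betaT β)^[j] 1 := by rw [← hg, ← hg, he]
  rcases lt_or_gt_of_ne hij with h | h
  · exact ⟨i, j - i, by omega, by rw [Nat.add_sub_cancel' h.le, he']⟩
  · exact ⟨j, i - j, by omega, by rw [Nat.add_sub_cancel' h.le, he']⟩

/-! ### The quasi-greedy expansion of one -/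

theorem iterate_betaT_zero (i : ℕ) : (betaT β)^[i] 0 = 0 :=
  Function.iterate_fixed (by simp [betaT]) i

theorem digit_eq_zero_of_iterate_eq_zero {x : ℝ} {j : ℕ} (h : (betaT β)^[j] x = 0) {i : ℕ}
    (hi : j ≤ i) : digit β x i = 0 := by
  obtain ⟨k, rfl⟩ := Nat.exists_eq_add_of_le hi
  rw [digit_add, h, digit, iterate_betaT_zero]
  simp

theorem digit_one_zero_pos [h : IsPisot β] : 0 < digit β 1 0 := by
  have : 1 < β := h.one_lt
  simp [digit, Nat.floor_pos, this.le]

theorem digit_eq_zero_of_lengthOne_le (h : FiniteOne β) {i : ℕ} (hi : lengthOne β ≤ i) :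
    digit β 1 i = 0 :=
  Nat.sInf_mem (s := {N : ℕ | ∀ i, N ≤ i → digit β 1 i = 0}) h i hi

theorem lengthOne_pos [IsPisot β] (h : FiniteOne β) : 0 < lengthOne β := by
  rw [Nat.pos_iff_ne_zero]
  intro h0
  have := digit_eq_zero_of_lengthOne_le h (i := 0) h0.le
  exact digit_one_zero_pos.ne' this

theorem exists_digit_ne_zero {N : ℕ} (hN : N < lengthOne β) : ∃ i, N ≤ i ∧ digit β 1 i ≠ 0 := by
  have := Nat.notMem_of_lt_sInf hN
  simpa using this

theorem digit_lengthOne_sub_one_pos [IsPisot β] (h : FiniteOne β) :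
    0 < digit β 1 (lengthOne β - 1) := by
  have h0 := lengthOne_pos h
  obtain ⟨i, hi, hi'⟩ := exists_digit_ne_zero (β := β) (N := lengthOne β - 1) (by omega)
  have : ¬ lengthOne β ≤ i := fun hle => hi' (digit_eq_zero_of_lengthOne_le h hle)
  obtain rfl : i = lengthOne β - 1 := by omega
  exact Nat.pos_of_ne_zero hi'

theorem iterate_lengthOne [IsPisot β] (h : FiniteOne β) : (betaT β)^[lengthOne β] 1 = 0 := by
  refine eq_of_digit_eq (β := β) ⟨iterate_betaT_nonneg zero_le_one _,
    iterate_betaT_le_one le_rfl _⟩ ⟨le_rfl, zero_le_one⟩ fun i => ?_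
  rw [← digit_add, digit_eq_zero_of_lengthOne_le h (Nat.le_add_right _ _),
    digit_eq_zero_of_iterate_eq_zero (j := 0) rfl (Nat.zero_le _)]

open Classical in
variable (β) in
/-- The value of the `k`-th shift of the quasi-greedy expansion `d*_β(1)`. -/
noncomputable def dval (k : ℕ) : ℝ :=
  if FiniteOne β then (betaT β)^[k % lengthOne β] 1 else (betaT β)^[k] 1

theorem exists_dval_eq_iterate (k : ℕ) : ∃ j, dval β k = (betaT β)^[j] 1 := by
  unfold dval
  split_ifs
  exacts [⟨_, rfl⟩, ⟨_, rfl⟩]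

theorem dval_nonneg (k : ℕ) : 0 ≤ dval β k := by
  obtain ⟨j, hj⟩ := exists_dval_eq_iterate (β := β) k
  exact hj ▸ iterate_betaT_nonneg zero_le_one j

theorem dval_le_one (k : ℕ) : dval β k ≤ 1 := by
  obtain ⟨j, hj⟩ := exists_dval_eq_iterate (β := β) k
  exact hj ▸ iterate_betaT_le_one le_rfl j

theorem dval_zero : dval β 0 = 1 := by
  simp [dval]

theorem dval_pos [IsPisot β] (k : ℕ) : 0 < dval β k := by
  refine (dval_nonneg k).lt_of_ne' fun h0 => ?_
  unfold dval at h0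
  split_ifs at h0 with h
  · have hN := lengthOne_pos h
    obtain ⟨i, hi, hi'⟩ := exists_digit_ne_zero (Nat.mod_lt k hN)
    exact hi' (digit_eq_zero_of_iterate_eq_zero h0 hi)
  · exact h ⟨k, fun i hi => digit_eq_zero_of_iterate_eq_zero h0 hi⟩

/-- When `d_β(1)` is finite, the index wraps at `lengthOne β`: the remainder there is 0, and
lowering the last digit by one trades it for the value 1 with which the cycle restarts. -/
theorem mul_dval [IsPisot β] (k : ℕ) : β * dval β k = dstar β k + dval β (k + 1) := by
  unfold dval dstar
  split_ifs with h hk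
  · have hN := lengthOne_pos h
    have hk' : k % lengthOne β = lengthOne β - 1 := by
      have h1 := Nat.mod_lt k hN
      rcases (Nat.succ_le_of_lt h1).eq_or_lt with h2 | h2
      · omega
      · rw [Nat.add_mod, Nat.mod_eq_of_lt (a := k % _ + 1 % _)] at hk
        · rcases Nat.eq_or_lt_of_le hN with h3 | h3
          · omega
          · rw [Nat.mod_eq_of_lt h3] at hk; omega
        · exact lt_of_le_of_lt (Nat.add_le_add_left (Nat.mod_le _ _) _) h2
    have h1 := mul_iterate_betaT (β := β) zero_le_one (lengthOne β - 1)
    rw [Nat.sub_add_cancel hN, iterate_lengthOne h] at h1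
    rw [hk', h1, hk, Nat.cast_sub (digit_lengthOne_sub_one_pos h)]
    simp
  · have hN := lengthOne_pos h
    have hk' : (k + 1) % lengthOne β = k % lengthOne β + 1 := by
      have h1 := Nat.mod_lt k hN
      have h2 : (k + 1) % lengthOne β = (k % lengthOne β + 1) % lengthOne β := by simp
      rcases (Nat.succ_le_of_lt h1).eq_or_lt with h3 | h3
      · rw [Nat.succ_eq_add_one] at h3
        rw [h2, h3, Nat.mod_self] at hk
        exact absurd rfl hk
      · rw [h2, Nat.mod_eq_of_lt h3]
    rw [hk', mul_iterate_betaT zero_le_one]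
  · exact mul_iterate_betaT zero_le_one k

theorem dval_eq_of_dstar_eq [IsPisot β] {k l : ℕ} (h : ∀ i, dstar β (k + i) = dstar β (l + i)) :
    dval β k = dval β l := by
  refine eq_of_bounded_expanding (β := β) (f := fun i => dval β (k + i))
    (g := fun i => dval β (l + i)) (fun i => ⟨dval_nonneg _, dval_le_one _⟩)
    (fun i => ⟨dval_nonneg _, dval_le_one _⟩) fun i => ?_
  have h1 := mul_dval (β := β) (k + i)
  have h2 := mul_dval (β := β) (l + i)
  rw [h i] at h1
  simp only [← add_assoc]
  linarith

theorem floor_mul_le_dstar [IsPisot β] {x : ℝ} {k : ℕ} (h0 : 0 ≤ x) (hx : x < dval β k) :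
    ⌊β * x⌋₊ ≤ dstar β k := by
  have h1 := mul_lt_mul_of_pos_left hx (pisot_pos (β := β))
  rw [mul_dval] at h1
  rw [← Nat.lt_add_one_iff, Nat.floor_lt (mul_nonneg pisot_pos.le h0)]
  push_cast
  linarith [dval_le_one (β := β) (k + 1)]

theorem dstar_le [IsPisot β] (k : ℕ) : (dstar β k : ℝ) ≤ β := by
  have h1 := mul_dval (β := β) k
  have h2 := mul_le_mul_of_nonneg_left (dval_le_one (β := β) k) (pisot_pos (β := β)).le
  linarith [dval_nonneg (β := β) (k + 1)]

theorem dstar_zero_pos [h : IsPisot β] : 0 < dstar β 0 := by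
  have h1 := mul_dval (β := β) 0
  rw [dval_zero, mul_one] at h1
  have : (0 : ℝ) < dstar β 0 := by linarith [dval_le_one (β := β) (0 + 1), h.one_lt]
  exact_mod_cast this

/-- As long as the digits agree, the strict inequality between remainders is multiplied by `β` and
persists; at the first disagreement `floor_mul_le_dstar` then decides the sign. Disagreement must
occur, since equal digits would force `x = 1`. -/
theorem lexLT_digit_dstar [IsPisot β] {x : ℝ} (h0 : 0 ≤ x) (hx : x < 1) :
    LexLT (digit β x) (dstar β) := by
  have hex : ∃ j, digit β x j ≠ dstar β j := by
    by_contra! hall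
    have : x = dval β 0 := by
      refine eq_of_bounded_expanding (β := β) (f := fun i => (betaT β)^[i] x) (g := dval β)
        (fun i => ⟨iterate_betaT_nonneg h0 i, iterate_betaT_le_one hx.le i⟩)
        (fun i => ⟨dval_nonneg _, dval_le_one _⟩) fun i => ?_
      have h1 := mul_iterate_betaT (β := β) h0 i
      have h2 := mul_dval (β := β) i
      rw [hall i] at h1
      linarith
    rw [dval_zero] at this
    exact hx.ne this
  classical
  have hlt : ∀ i ≤ Nat.find hex, (betaT β)^[i] x < dval β i := by
    intro i
    induction i with
    | zero => intro _; rw [dval_zero]; exact hx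
    | succ i ih =>
      intro hi
      have h1 := mul_iterate_betaT (β := β) h0 i
      have h2 := mul_dval (β := β) i
      have h3 := mul_lt_mul_of_pos_left (ih (by omega)) (pisot_pos (β := β))
      have h4 := Nat.find_min hex (m := i) (by omega)
      rw [not_not.1 h4] at h1
      linarith
  refine ⟨Nat.find hex, fun i hi => not_not.1 (Nat.find_min hex hi), ?_⟩
  exact (floor_mul_le_dstar (iterate_betaT_nonneg h0 _) (hlt _ le_rfl)).lt_of_ne
    (Nat.find_spec hex)

/-! ### The nodes of the admissibility graph -/

theorem exists_period_dstar [IsPisot β] :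
    ∃ m p : ℕ, 0 < p ∧ ∀ k, m ≤ k → dstar β (k + p) = dstar β k := by
  by_cases h : FiniteOne β
  · refine ⟨0, lengthOne β, lengthOne_pos h, fun k _ => ?_⟩
    unfold dstar
    rw [if_pos h, if_pos h, Nat.add_right_comm]
    simp
  · obtain ⟨i, p, hp, he⟩ := exists_iterate_one_eq (β := β)
    refine ⟨i, p, hp, fun k hk => ?_⟩
    unfold dstar
    rw [if_neg h, if_neg h]
    obtain ⟨l, rfl⟩ := Nat.exists_eq_add_of_le hk
    rw [Nat.add_right_comm, digit_add, he, ← digit_add]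

theorem perLen_spec [IsPisot β] :
    0 < perLen β ∧ ∀ k, preLen β ≤ k → dstar β (k + perLen β) = dstar β k := by
  have h1 : preLen β ∈ {m : ℕ | ∃ p : ℕ, 0 < p ∧ ∀ k, m ≤ k → dstar β (k + p) = dstar β k} :=
    Nat.sInf_mem exists_period_dstar
  exact Nat.sInf_mem (s := {p : ℕ | 0 < p ∧ ∀ k, preLen β ≤ k → dstar β (k + p) = dstar β k}) h1

theorem numNodes_pos [IsPisot β] : 0 < numNodes β :=
  Nat.add_pos_right _ perLen_spec.1

theorem dval_numNodes [IsPisot β] : dval β (numNodes β) = dval β (preLen β) := by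
  refine dval_eq_of_dstar_eq fun i => ?_
  rw [numNodes, Nat.add_right_comm]
  exact perLen_spec.2 _ (Nat.le_add_right _ _)

theorem numNodes_le_lengthOne [IsPisot β] (h : FiniteOne β) : numNodes β ≤ lengthOne β := by
  have hN : 0 < lengthOne β ∧ ∀ k, 0 ≤ k → dstar β (k + lengthOne β) = dstar β k := by
    refine ⟨lengthOne_pos h, fun k _ => ?_⟩
    unfold dstar
    rw [if_pos h, if_pos h, Nat.add_right_comm]
    simp
  have h0 : preLen β = 0 := Nat.le_zero.1 (Nat.sInf_le ⟨_, hN⟩)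
  have h1 : perLen β ≤ lengthOne β := by
    refine Nat.sInf_le ?_
    rw [h0]
    exact hN
  rw [numNodes, h0, zero_add]
  exact h1

/-- A node index minus one is below `lengthOne β` in the finite case, so no wrapping takes place and
the threshold of a node is a true iterate of 1. -/
theorem dval_eq_iterate_of_mem_nodes [IsPisot β] {a : ℕ} (ha : a ∈ nodes β) :
    (betaT β)^[a - 1] 1 = dval β (a - 1) := by
  unfold dval
  split_ifs with h
  · rw [Nat.mod_eq_of_lt]
    have := numNodes_le_lengthOne h
    have h1 : 1 ≤ a := ha.1
    have h2 : a ≤ numNodes β := ha.2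
    omega
  · rfl

theorem one_mem_nodes [IsPisot β] : 1 ∈ nodes β := ⟨le_rfl, numNodes_pos⟩

theorem nodes_finite : (nodes β).Finite := Set.finite_Icc _ _

theorem Edge.mem_nodes_right [IsPisot β] {b ε a : ℕ} (h : Edge β b ε a) : a ∈ nodes β := by
  cases h with
  | reset hb hε => exact one_mem_nodes
  | next hb hn => exact ⟨Nat.le_add_left _ _, hn⟩
  | loop => exact ⟨Nat.le_add_left _ _, Nat.add_le_add_left (perLen_spec (β := β)).1 _⟩

theorem Edge.le_dstar {b ε a : ℕ} (h : Edge β b ε a) : ε ≤ dstar β (b - 1) := by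
  cases h with
  | reset hb hε => exact hε.le
  | next hb hn => exact le_rfl
  | loop => exact le_rfl

/-- Attach to each node `a` the interval `[0, dval β (a - 1))`. An edge `b --ε--> a` then sends the
interval of `a` into that of `b` by `x ↦ (ε + x) / β`; `exists_edge` says conversely that every
point of the interval of `b` follows an edge. -/
theorem Edge.add_le [IsPisot β] {b ε a : ℕ} (h : Edge β b ε a) :
    ε + dval β (a - 1) ≤ β * dval β (b - 1) := by
  rw [mul_dval]
  cases h with
  | reset hb hε =>
    have : (ε : ℝ) + 1 ≤ dstar β (b - 1) := by exact_mod_cast hε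
    rw [Nat.sub_self, dval_zero]
    linarith [dval_nonneg (β := β) (b - 1 + 1)]
  | next hb hn =>
    have : 1 ≤ b := hb.1
    rw [Nat.add_sub_cancel, Nat.sub_add_cancel this]
  | loop =>
    rw [Nat.add_sub_cancel, Nat.sub_add_cancel numNodes_pos, dval_numNodes]

theorem exists_edge [IsPisot β] {b : ℕ} (hb : b ∈ nodes β) {x : ℝ} (h0 : 0 ≤ x)
    (hx : x < dval β (b - 1)) : ∃ a, Edge β b ⌊β * x⌋₊ a ∧ betaT β x < dval β (a - 1) := by
  have hb1 : 1 ≤ b := hb.1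
  rcases (floor_mul_le_dstar h0 hx).eq_or_lt with h | h
  · have h1 : betaT β x < dval β b := by
      have h1 := mul_eq_floor_add_betaT (β := β) h0
      have h2 := mul_lt_mul_of_pos_left hx (pisot_pos (β := β))
      rw [mul_dval, Nat.sub_add_cancel hb1, h1, h] at h2
      linarith
    rw [h]
    have hb2 : b ≤ numNodes β := hb.2
    rcases hb2.eq_or_lt with h2 | h2
    · rw [h2, dval_numNodes] at h1
      exact ⟨_, h2 ▸ Edge.loop, h1⟩
    · exact ⟨_, Edge.next hb h2, h1⟩
  · refine ⟨1, Edge.reset hb h, ?_⟩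
    rw [Nat.sub_self, dval_zero]
    exact betaT_lt_one _

/-! ### Words conducting to a node -/

theorem Conducts.mem_nodes [IsPisot β] {w : List ℕ} {a : ℕ} (h : Conducts β w a) :
    a ∈ nodes β := by
  cases h with
  | nil => exact one_mem_nodes
  | snoc hw he => exact he.mem_nodes_right

theorem ofDigits_nil' {R : Type*} [Semiring R] (r : R) : Nat.ofDigits r [] = 0 := rfl

theorem ofDigits_cons' {R : Type*} [Semiring R] (r : R) (ε : ℕ) (w : List ℕ) :
    Nat.ofDigits r (ε :: w) = ε + r * Nat.ofDigits r w := rfl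

theorem ofDigits_reverse_snoc {R : Type*} [Semiring R] (r : R) (w : List ℕ) (ε : ℕ) :
    Nat.ofDigits r (w ++ [ε]).reverse = ε + r * Nat.ofDigits r w.reverse := by
  rw [List.reverse_append, List.reverse_singleton, List.singleton_append, ofDigits_cons']

theorem map_ofDigits {R S : Type*} [Semiring R] [Semiring S] (f : R →+* S) (r : R) (w : List ℕ) :
    f (Nat.ofDigits r w) = Nat.ofDigits (f r) w := by
  induction w with
  | nil => simp [ofDigits_nil']
  | cons a w ih => simp [ofDigits_cons', ih]

theorem coe_ofDigits_gen (w : List ℕ) :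
    ((Nat.ofDigits (gen β) w : ℚ⟮β⟯) : ℝ) = Nat.ofDigits β w :=
  map_ofDigits (algebraMap ℚ⟮β⟯ ℝ) (gen β) w

theorem ofDigits_gen_mem (w : List ℕ) :
    (Nat.ofDigits (gen β) w : ℚ⟮β⟯) ∈ Algebra.adjoin ℤ {gen β} := by
  induction w with
  | nil => simp [ofDigits_nil']
  | cons a w ih =>
    rw [ofDigits_cons']
    exact add_mem (natCast_mem _ _) (mul_mem (Algebra.self_mem_adjoin_singleton _ _) ih)

/-- Horner's scheme reads the word from left to right, and the constant of `exists_conj_bound` is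
stable under each step. The bound is therefore independent of the length of the word. -/
theorem Conducts.norm_conj_le [IsPisot β] {C : ℝ} (hC0 : 0 ≤ C)
    (hC : ∀ σ : ℚ⟮β⟯ →+* ℂ, σ ≠ stdEmb β → β + ‖σ (gen β)‖ * C ≤ C) {w : List ℕ} {a : ℕ}
    (h : Conducts β w a) {σ : ℚ⟮β⟯ →+* ℂ} (hσ : σ ≠ stdEmb β) :
    ‖σ (Nat.ofDigits (gen β) w.reverse)‖ ≤ C := by
  induction h with
  | nil => simpa [ofDigits_nil'] using hC0
  | @snoc w b ε a hw he ih =>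
    rw [ofDigits_reverse_snoc, map_add, map_mul, map_natCast]
    refine (norm_add_le _ _).trans (le_trans ?_ (hC σ hσ))
    rw [norm_mul, Complex.norm_natCast]
    refine add_le_add ?_ (mul_le_mul_of_nonneg_left ih (norm_nonneg _))
    exact le_trans (by exact_mod_cast he.le_dstar) (dstar_le (β := β) (b - 1))

/-- If `w` conducts to the node `a`, then `w` followed by the expansion of any `x` in
`[0, T^(a-1)(1))` is a `β`-expansion. -/
theorem Conducts.exists_prefix [IsPisot β] {w : List ℕ} {a : ℕ} (h : Conducts β w a) {x : ℝ}
    (h0 : 0 ≤ x) (hx : x < dval β (a - 1)) :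
    ∃ s : ℝ, 0 ≤ s ∧ s < 1 ∧ (betaT β)^[w.length] s = x ∧
      β ^ w.length * s = Nat.ofDigits β w.reverse + x ∧
      ∀ i, i < w.length → digit β s i = w.getD i 0 := by
  induction h generalizing x with
  | nil => exact ⟨x, h0, hx.trans_le (dval_le_one _), rfl, by simp [ofDigits_nil'], by simp⟩
  | @snoc w b ε a hw he ih =>
    have hβ := pisot_pos (β := β)
    -- The preimage of `x` under the branch of digit `ε`; the induction hypothesis is applied to it
    -- at the node `b`.
    have hlt : (ε + x) / β < dval β (b - 1) := by
      rw [div_lt_iff₀' hβ]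
      linarith [he.add_le]
    have hy0 : 0 ≤ (ε + x) / β := by positivity
    have hmul : β * ((ε + x) / β) = x + (ε : ℕ) := by field_simp; ring
    have hx1 : x < 1 := hx.trans_le (dval_le_one _)
    have hT : betaT β ((ε + x) / β) = x := by
      rw [betaT, hmul, Int.fract_add_natCast, Int.fract_eq_self.2 ⟨h0, hx1⟩]
    have hfl : ⌊β * ((ε + x) / β)⌋₊ = ε := by
      rw [hmul, Nat.floor_add_natCast h0, Nat.floor_eq_zero.2 hx1, zero_add]
    obtain ⟨s, hs0, hs1, hs2, hs3, hs4⟩ := ih hy0 hlt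
    have hlen : (w ++ [ε]).length = w.length + 1 := by simp
    refine ⟨s, hs0, hs1, ?_, ?_, ?_⟩
    · rw [hlen, Function.iterate_succ_apply', hs2, hT]
    · rw [hlen, pow_succ', mul_assoc, hs3, ofDigits_reverse_snoc, mul_add, hmul]
      ring
    · intro i hi
      rw [hlen] at hi
      rcases (Nat.lt_succ_iff.1 hi).eq_or_lt with h1 | h1
      · rw [digit, h1, hs2, hfl]
        simp
      · rw [hs4 i h1, List.getD_append _ _ _ _ h1]

/-- The word completed by zeros is the expansion of the point `s` obtained for `x = 0`, so its
shifts are expansions of points of `[0,1)`. Admissibility is thus automatic along paths from node 1.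
-/
theorem Conducts.admissible [IsPisot β] {w : List ℕ} {a : ℕ} (h : Conducts β w a) :
    Admissible β w := by
  obtain ⟨s, hs0, hs1, hs2, -, hs4⟩ := h.exists_prefix le_rfl (dval_pos _)
  intro k
  have : (fun i => w.getD (k + i) 0) = digit β ((betaT β)^[k] s) := by
    funext i
    rw [← digit_add]
    rcases lt_or_ge (k + i) w.length with h1 | h1
    · exact (hs4 _ h1).symm
    · rw [digit_eq_zero_of_iterate_eq_zero hs2 h1, List.getD_eq_default _ _ h1]
  rw [this]
  exact lexLT_digit_dstar (iterate_betaT_nonneg hs0 k) (iterate_betaT_lt_one hs1 k)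

theorem mem_lang_iff [IsPisot β] {w : List ℕ} {a : ℕ} : w ∈ lang β a ↔ Conducts β w a :=
  ⟨fun h => h.2, fun h => ⟨h.admissible, h⟩⟩

/-- Since `t_1 > 0`, the initial node carries a loop labelled 0. Padding with leading zeros
lengthens a word without changing its value. -/
theorem Conducts.cons_zero [IsPisot β] {w : List ℕ} {a : ℕ} (h : Conducts β w a) :
    Conducts β (0 :: w) a := by
  induction h with
  | nil => exact Conducts.snoc Conducts.nil (Edge.reset one_mem_nodes dstar_zero_pos)
  | snoc hw he ih => exact Conducts.snoc ih he

theorem Conducts.replicate_zero_append [IsPisot β] {w : List ℕ} {a : ℕ} (h : Conducts β w a)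
    (j : ℕ) : Conducts β (List.replicate j 0 ++ w) a := by
  induction j with
  | zero => exact h
  | succ j ih => exact ih.cons_zero

/-- The first `p` digits of `s ∈ [0,1)` label a path of the admissibility graph. -/
theorem exists_conducts_of_expansion [IsPisot β] {s : ℝ} (h0 : 0 ≤ s) (h1 : s < 1) (p : ℕ) :
    ∃ w a, Conducts β w a ∧ (betaT β)^[p] s < dval β (a - 1) ∧
      β ^ p * s = Nat.ofDigits β w.reverse + (betaT β)^[p] s := by
  induction p with
  | zero => exact ⟨[], 1, Conducts.nil, by simpa [dval_zero] using h1,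
    by simp [ofDigits_nil']⟩
  | succ p ih =>
    obtain ⟨w, b, hw, hlt, he⟩ := ih
    obtain ⟨a, hedge, ha⟩ := exists_edge hw.mem_nodes (iterate_betaT_nonneg h0 p) hlt
    refine ⟨_, a, hw.snoc hedge, ?_, ?_⟩
    · rwa [Function.iterate_succ_apply']
    · have h2 := mul_iterate_betaT (β := β) h0 p
      rw [digit] at h2
      rw [pow_succ', mul_assoc, he, ofDigits_reverse_snoc, mul_add]
      linarith

/-- A number `y ≥ 0` is the sum of a `β`-integer and of its fractional part. -/
theorem exists_conducts_add_fracPart [h : IsPisot β] {y : ℝ} (hy : 0 ≤ y) :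
    ∃ w a, Conducts β w a ∧ y = Nat.ofDigits β w.reverse + fracPart β y ∧
      0 ≤ fracPart β y ∧ fracPart β y < 1 := by
  have hne : {p : ℕ | y / β ^ p < 1}.Nonempty := by
    obtain ⟨p, hp⟩ := pow_unbounded_of_one_lt y h.one_lt
    exact ⟨p, (div_lt_one (pow_pos (pisot_pos (β := β)) p)).2 hp⟩
  have hp := Nat.sInf_mem hne
  set p := sInf {p : ℕ | y / β ^ p < 1} with hpdef
  have hpos := pow_pos (pisot_pos (β := β)) p
  have h0 : 0 ≤ y / β ^ p := by positivity
  have hf : fracPart β y = (betaT β)^[p] (y / β ^ p) := rfl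
  obtain ⟨w, a, hw, -, he⟩ := exists_conducts_of_expansion (β := β) h0 hp p
  rw [mul_div_cancel₀ _ hpos.ne'] at he
  exact ⟨w, a, hw, hf ▸ he, hf ▸ iterate_betaT_nonneg h0 p, hf ▸ iterate_betaT_lt_one hp p⟩

/-! ### Arithmetic of `ℤ_(N(β))` -/

theorem gen_ne_zero [IsPisot β] : gen β ≠ 0 := by
  intro h
  have h1 : ((gen β : ℚ⟮β⟯) : ℝ) = 0 := by rw [h]; rfl
  exact (pisot_pos (β := β)).ne' h1

theorem genInt_ne_zero [IsPisot β] : genInt β ≠ 0 := fun h =>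
  gen_ne_zero (β := β) (congrArg (algebraMap (𝓞 ℚ⟮β⟯) ℚ⟮β⟯) h)

variable (β) in
/-- The absolute value of the norm of `β`. -/
noncomputable def absNorm [IsPisot β] : ℕ := (Algebra.norm ℤ (genInt β)).natAbs

theorem absNorm_pos [IsPisot β] : 0 < absNorm β :=
  Int.natAbs_pos.2 (Algebra.norm_ne_zero_iff.2 genInt_ne_zero)

/-- Up to sign the norm is the constant coefficient of the minimal polynomial, which `β` divides in
`ℤ[β]`. -/
theorem exists_gen_mul_eq_absNorm [IsPisot β] :
    ∃ g ∈ Algebra.adjoin ℤ {gen β}, gen β * g = (absNorm β : ℚ⟮β⟯) := by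
  have hint : IsIntegral ℚ β := (IsPisot.isIntegral (β := β)).tower_top
  obtain ⟨ε, hε⟩ : ∃ ε : ℤ, (absNorm β : ℤ) = ε * (minpoly ℤ (gen β)).coeff 0 := by
    have h1 : Algebra.norm ℤ (genInt β) =
        (-1) ^ (IntermediateField.adjoin.powerBasis hint).dim * (minpoly ℤ (gen β)).coeff 0 := by
      have h2 := Algebra.PowerBasis.norm_gen_eq_coeff_zero_minpoly
        (IntermediateField.adjoin.powerBasis hint)
      rw [IntermediateField.adjoin.powerBasis_gen] at h2
      have h3 : Algebra.norm ℚ (gen β) = (-1) ^ (IntermediateField.adjoin.powerBasis hint).dim *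
        (minpoly ℚ (gen β)).coeff 0 := h2
      rw [minpoly.isIntegrallyClosed_eq_field_fractions' ℚ (gen_isIntegral β),
        Polynomial.coeff_map] at h3
      have h4 := Algebra.coe_norm_int (genInt β)
      have h5 : ((genInt β : 𝓞 ℚ⟮β⟯) : ℚ⟮β⟯) = gen β := rfl
      rw [h5, h3] at h4
      have h6 : ((Algebra.norm ℤ (genInt β) : ℤ) : ℚ) =
        (((-1) ^ (IntermediateField.adjoin.powerBasis hint).dim *
          (minpoly ℤ (gen β)).coeff 0 : ℤ) : ℚ) := by
        rw [h4]; push_cast; rfl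
      exact_mod_cast h6
    rcases Int.natAbs_eq (Algebra.norm ℤ (genInt β)) with h | h
    · exact ⟨(-1) ^ (IntermediateField.adjoin.powerBasis hint).dim, by rw [absNorm, ← h, h1]⟩
    · refine ⟨-(-1) ^ (IntermediateField.adjoin.powerBasis hint).dim, ?_⟩
      rw [neg_mul, ← h1, absNorm]
      omega
  have h1 := minpoly.aeval ℤ (gen β)
  rw [← Polynomial.divX_mul_X_add (minpoly ℤ (gen β))] at h1
  simp only [map_add, map_mul, Polynomial.aeval_X, Polynomial.aeval_C] at h1
  refine ⟨-(ε : ℚ⟮β⟯) * Polynomial.aeval (gen β) (minpoly ℤ (gen β)).divX, ?_, ?_⟩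
  · exact mul_mem (neg_mem (intCast_mem _ _)) (Polynomial.aeval_mem_adjoin_singleton _ _)
  · have h2 : (absNorm β : ℚ⟮β⟯) = ε * (((minpoly ℤ (gen β)).coeff 0 : ℤ) : ℚ⟮β⟯) := by
      exact_mod_cast congrArg (Int.cast (R := ℚ⟮β⟯)) hε
    rw [eq_intCast] at h1
    rw [h2, eq_neg_of_add_eq_zero_right h1]
    ring

/-- `β` is invertible modulo any integer `d` prime to its norm. -/
theorem exists_pow_gen_sub_one [IsPisot β] {d : ℕ} (hd0 : d ≠ 0) (hd : Nat.Coprime d (absNorm β)) :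
    ∃ h : ℕ, 0 < h ∧ ∃ m ∈ Algebra.adjoin ℤ {gen β}, gen β ^ h - 1 = d * m := by
  let R := Algebra.adjoin ℤ {gen β}
  have hfin : Module.Finite ℤ R := Module.Finite.iff_fg.2 (gen_isIntegral β).fg_adjoin_singleton
  let I : Ideal R := Ideal.span {(d : R)}
  have hI : I ≠ ⊥ := by
    rw [Ne, Ideal.span_singleton_eq_bot]
    exact_mod_cast hd0
  have hQ : Finite (R ⧸ I) := Ring.HasFiniteQuotients.finiteQuotient hI
  obtain ⟨g, hg, hgN⟩ := exists_gen_mul_eq_absNorm (β := β)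
  let b : R := ⟨gen β, Algebra.self_mem_adjoin_singleton _ _⟩
  have hb : IsUnit (Ideal.Quotient.mk I b) := by
    obtain ⟨x, y, hxy⟩ := Nat.isCoprime_iff_coprime.2 hd
    have h1 : (x : R) * (d : R) + y * (absNorm β : R) = 1 := by
      exact_mod_cast congrArg (Int.cast (R := R)) hxy
    have h2 : b * ⟨g, hg⟩ = (absNorm β : R) := Subtype.ext (by simpa [b] using hgN)
    refine IsUnit.of_mul_eq_one (Ideal.Quotient.mk I (⟨g, hg⟩ * y)) ?_
    rw [← map_mul, ← map_one (Ideal.Quotient.mk I), Ideal.Quotient.eq, ← mul_assoc, h2, ← h1]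
    refine Ideal.mem_span_singleton.2 ⟨-x, by ring⟩
  -- The quotient `ℤ[β]/(d)` is finite, so the unit given by `β` has finite order, which serves as
  -- the exponent.
  obtain ⟨u, hu⟩ := hb
  refine ⟨orderOf u, orderOf_pos u, ?_⟩
  have h1 : Ideal.Quotient.mk I (b ^ orderOf u - 1) = 0 := by
    rw [map_sub, map_pow, ← hu, ← Units.val_pow_eq_pow_val, pow_orderOf_eq_one]
    simp
  rw [Ideal.Quotient.eq_zero_iff_mem, Ideal.mem_span_singleton] at h1
  obtain ⟨m, hm⟩ := h1
  refine ⟨m, m.2, ?_⟩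
  have := congrArg (Subtype.val) hm
  simpa [b] using this

theorem mem_ZN_of_den_dvd [IsPisot β] {q : ℚ} {d : ℕ} (h : q.den ∣ d)
    (hd : Nat.Coprime d (absNorm β)) : q ∈ ZN β := hd.coprime_dvd_left h

theorem intCast_mem_ZN [IsPisot β] (n : ℤ) : (n : ℚ) ∈ ZN β :=
  mem_ZN_of_den_dvd (d := 1) (by simp) (Nat.coprime_one_left _)

theorem natCast_mem_ZN [IsPisot β] (n : ℕ) : (n : ℚ) ∈ ZN β := by
  exact_mod_cast intCast_mem_ZN (β := β) n

theorem mul_mem_ZN [IsPisot β] {q r : ℚ} (hq : q ∈ ZN β) (hr : r ∈ ZN β) : q * r ∈ ZN β :=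
  mem_ZN_of_den_dvd (Rat.mul_den_dvd q r) (Nat.Coprime.mul_left hq hr)

theorem sub_mem_ZN [IsPisot β] {q r : ℚ} (hq : q ∈ ZN β) (hr : r ∈ ZN β) : q - r ∈ ZN β := by
  rw [sub_eq_add_neg]
  refine mem_ZN_of_den_dvd (Rat.add_den_dvd q (-r)) (Nat.Coprime.mul_left hq ?_)
  rw [Rat.neg_den]
  exact hr

theorem div_mem_ZN [IsPisot β] (i : ℤ) {d : ℕ} (hd : Nat.Coprime d (absNorm β)) :
    (i / d : ℚ) ∈ ZN β := by
  refine mem_ZN_of_den_dvd ?_ hd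
  have h := Rat.den_dvd i d
  rw [Rat.divInt_eq_div] at h
  exact_mod_cast h

/-- Multiples of `N(β)^k` in `ℤ_(N(β))` are dense in `ℝ`. -/
theorem exists_mem_ZN_between [IsPisot β] (k : ℕ) {a b : ℝ} (hab : a < b) :
    ∃ e ∈ ZN β, a < ((absNorm β ^ k * e : ℚ) : ℝ) ∧ ((absNorm β ^ k * e : ℚ) : ℝ) < b := by
  have hN : (0 : ℝ) < (absNorm β : ℝ) ^ k := pow_pos (by exact_mod_cast absNorm_pos) k
  obtain ⟨j, hj⟩ := exists_nat_gt ((absNorm β : ℝ) ^ k / (b - a))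
  -- Denominators of the form `j N(β) + 1` are prime to the norm. For large `j` the multiples of
  -- `N(β)^k / M` have mesh less than `b - a`, and the first one beyond `a` is chosen.
  have hM : Nat.Coprime (j * absNorm β + 1) (absNorm β) := by simp
  have hM0 : (0 : ℝ) < ((j * absNorm β + 1 : ℕ) : ℝ) := by positivity
  have hjM : (j : ℝ) < ((j * absNorm β + 1 : ℕ) : ℝ) := by
    have : j ≤ j * absNorm β := Nat.le_mul_of_pos_right j absNorm_pos
    exact_mod_cast Nat.lt_succ_of_le this
  set M := j * absNorm β + 1
  have hs : (absNorm β : ℝ) ^ k / M < b - a := by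
    rw [div_lt_iff₀ hM0]
    rw [div_lt_iff₀ (sub_pos.2 hab)] at hj
    nlinarith [sub_pos.2 hab]
  set s : ℝ := (absNorm β : ℝ) ^ k / M with hsdef
  have hs0 : 0 < s := div_pos hN hM0
  refine ⟨((⌊a / s⌋ + 1 : ℤ) / M : ℚ), div_mem_ZN _ hM, ?_⟩
  have he : (((absNorm β : ℚ) ^ k * (((⌊a / s⌋ + 1 : ℤ) : ℚ) / (M : ℚ)) : ℚ) : ℝ) =
      (⌊a / s⌋ + 1) * s := by
    rw [hsdef]; push_cast; ring
  rw [he]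
  have h1 := Int.lt_floor_add_one (a / s)
  have h2 := Int.floor_le (a / s)
  rw [div_lt_iff₀ hs0] at h1
  rw [le_div_iff₀ hs0] at h2
  exact ⟨h1, by linarith⟩

/-- Residues of `ℤ_(N(β))` modulo `N(β)^k`. -/
theorem exists_sub_natCast_eq [IsPisot β] (k : ℕ) {q : ℚ} (hq : q ∈ ZN β) :
    ∃ i < absNorm β ^ k, ∃ e ∈ ZN β, q - i = absNorm β ^ k * e := by
  have hpos : 0 < absNorm β ^ k := pow_pos absNorm_pos k
  have hcop : IsCoprime (q.den : ℤ) ((absNorm β ^ k : ℕ) : ℤ) :=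
    Nat.isCoprime_iff_coprime.2 (Nat.Coprime.pow_right k hq)
  -- By this Bézout relation `x` inverts the denominator modulo `N(β)^k`, so the residue of `q` is
  -- that of `q.num * x`.
  obtain ⟨x, y, hxy⟩ := hcop
  have hpos' : (0 : ℤ) < ((absNorm β ^ k : ℕ) : ℤ) := by exact_mod_cast hpos
  obtain ⟨i, hi⟩ := Int.eq_ofNat_of_zero_le
    (Int.emod_nonneg (q.num * x) hpos'.ne')
  have hilt : (i : ℤ) < ((absNorm β ^ k : ℕ) : ℤ) := by
    have := Int.emod_lt_of_pos (q.num * x) hpos'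
    rw [hi] at this
    exact this
  refine ⟨i, by exact_mod_cast hilt,
    ((q.num * y - q.den * -(q.num * x / ((absNorm β ^ k : ℕ) : ℤ)) : ℤ) / q.den : ℚ),
    div_mem_ZN _ hq, ?_⟩
  have h1 := Int.emod_add_mul_ediv (q.num * x) ((absNorm β ^ k : ℕ) : ℤ)
  rw [hi] at h1
  have hd : (q.den : ℚ) ≠ 0 := by exact_mod_cast q.den_nz
  have h2 : ((i : ℤ) : ℚ) + (absNorm β : ℚ) ^ k *
      ((q.num * x / ((absNorm β ^ k : ℕ) : ℤ) : ℤ) : ℚ) = q.num * x := by exact_mod_cast h1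
  have h3 : (x : ℚ) * q.den + y * (absNorm β : ℚ) ^ k = 1 := by exact_mod_cast hxy
  have h4 : q * q.den = q.num := Rat.mul_den_eq_num q
  have h5 : ((i : ℕ) : ℚ) = ((i : ℤ) : ℚ) := by push_cast; rfl
  rw [mul_div_assoc', eq_div_iff hd, sub_mul, h4, h5]
  push_cast at h2 ⊢
  linear_combination (-(q.num : ℚ)) * h3 - (q.den : ℚ) * h2

/-! ### Primes containing `β` -/

theorem absNorm_mem [IsPisot β] (P : Primes β) : (absNorm β : 𝓞 ℚ⟮β⟯) ∈ P.1.asIdeal := by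
  obtain ⟨g, hg, hgN⟩ := exists_gen_mul_eq_absNorm (β := β)
  have : (absNorm β : 𝓞 ℚ⟮β⟯) = genInt β * ⟨g, isIntegral_of_mem_adjoin hg⟩ := by
    apply RingOfIntegers.ext
    refine (map_natCast (algebraMap (𝓞 ℚ⟮β⟯) ℚ⟮β⟯) _).trans ?_
    rw [← hgN]
    rfl
  rw [this]
  exact Ideal.mul_mem_right _ _ P.2

instance [IsPisot β] : Finite (Primes β) := by
  have h : Ideal.span {genInt β} ≠ 0 := by
    rw [Ne, Ideal.zero_eq_bot, Ideal.span_singleton_eq_bot]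
    exact genInt_ne_zero
  refine ((Ideal.finite_factors h).subset ?_).to_subtype (s := {P | genInt β ∈ P.asIdeal})
  intro P hP
  exact Ideal.dvd_span_singleton.2 hP

theorem valuation_absNorm_lt_one [IsPisot β] (P : Primes β) :
    P.1.valuation ℚ⟮β⟯ (absNorm β : ℚ⟮β⟯) < 1 := by
  have : P.1.valuation ℚ⟮β⟯ (algebraMap (𝓞 ℚ⟮β⟯) ℚ⟮β⟯ (absNorm β)) < 1 :=
    (P.1.valuation_lt_one_iff_mem (K := ℚ⟮β⟯) _).2 (absNorm_mem P)
  rwa [map_natCast] at this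

theorem valuation_gen_lt_one [IsPisot β] (P : Primes β) :
    P.1.valuation ℚ⟮β⟯ (gen β) < 1 :=
  (P.1.valuation_lt_one_iff_mem (K := ℚ⟮β⟯) (genInt β)).2 P.2

theorem valuation_le_one_of_isIntegral [IsPisot β] (P : HeightOneSpectrum (𝓞 ℚ⟮β⟯)) {x : ℚ⟮β⟯}
    (hx : IsIntegral ℤ x) : P.valuation ℚ⟮β⟯ x ≤ 1 :=
  P.valuation_le_one (K := ℚ⟮β⟯) ⟨x, hx⟩

theorem valuation_eq_one_of_coprime [IsPisot β] (P : Primes β) {d : ℕ}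
    (hd : Nat.Coprime d (absNorm β)) : P.1.valuation ℚ⟮β⟯ (d : ℚ⟮β⟯) = 1 := by
  have h := (P.1.valuation_eq_one_iff_notMem (K := ℚ⟮β⟯) (r := (d : 𝓞 ℚ⟮β⟯))).2 ?_
  · rwa [map_natCast] at h
  · intro hmem
    apply P.1.isPrime.ne_top
    obtain ⟨x, y, hxy⟩ := (Nat.isCoprime_iff_coprime.2 hd)
    have h1 : (x : 𝓞 ℚ⟮β⟯) * (d : 𝓞 ℚ⟮β⟯) + y * (absNorm β : 𝓞 ℚ⟮β⟯) = 1 := by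
      exact_mod_cast congrArg (Int.cast (R := 𝓞 ℚ⟮β⟯)) hxy
    rw [Ideal.eq_top_iff_one, ← h1]
    exact add_mem (Ideal.mul_mem_left _ _ hmem) (Ideal.mul_mem_left _ _ (absNorm_mem P))

theorem valuation_le_one_of_mem_ZN [IsPisot β] (P : Primes β) {q : ℚ} (hq : q ∈ ZN β) :
    P.1.valuation ℚ⟮β⟯ (q : ℚ⟮β⟯) ≤ 1 := by
  rw [Rat.cast_def, map_div₀, valuation_eq_one_of_coprime P hq, div_one]
  exact valuation_le_one_of_isIntegral _ (isIntegral_algebraMap (R := ℤ))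

/-- A prime `p` dividing both the denominator and the norm lies under some prime ideal containing
`β`. Integrality of `q` there puts the numerator in that ideal, so `p` divides it as well, contrary
to reducedness. -/
theorem mem_ZN_of_integralAtBeta [IsPisot β] {q : ℚ} (hq : IntegralAtBeta β q) : q ∈ ZN β := by
  by_contra hcop
  obtain ⟨p, hp, hpd, hpN⟩ := Nat.Prime.not_coprime_iff_dvd.1 hcop
  have hpN' : p ∣ Ideal.absNorm (Ideal.span {genInt β}) := by
    rwa [Ideal.absNorm_span_singleton]
  obtain ⟨P, hPmax, hPp, hPβ⟩ := Ideal.exists_isMaximal_dvd_of_dvd_absNorm' hp _ hpN'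
  have hpP : (p : 𝓞 ℚ⟮β⟯) ∈ P := by
    have : (p : ℤ) ∈ P.under ℤ := by rw [hPp]; exact Ideal.mem_span_singleton_self _
    simpa [Ideal.under] using this
  have hPbot : P ≠ ⊥ := by
    rintro rfl
    rw [Ideal.mem_bot] at hpP
    exact hp.ne_zero (by exact_mod_cast hpP)
  let v : HeightOneSpectrum (𝓞 ℚ⟮β⟯) := ⟨P, hPmax.isPrime, hPbot⟩
  have h1 : v.valuation ℚ⟮β⟯ (q : ℚ⟮β⟯) ≤ 1 := hq ⟨v, Ideal.dvd_span_singleton.1 hPβ⟩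
  have hden : v.valuation ℚ⟮β⟯ (q.den : ℚ⟮β⟯) < 1 := by
    have : v.valuation ℚ⟮β⟯ (algebraMap (𝓞 ℚ⟮β⟯) ℚ⟮β⟯ q.den) < 1 :=
      (v.valuation_lt_one_iff_mem (K := ℚ⟮β⟯) (q.den : 𝓞 ℚ⟮β⟯)).2 (by
      obtain ⟨c, hc⟩ := hpd
      rw [hc, Nat.cast_mul]
      exact Ideal.mul_mem_right _ _ hpP)
    rwa [map_natCast] at this
  have hnum : v.valuation ℚ⟮β⟯ (q.num : ℚ⟮β⟯) < 1 := by
    have : (q.num : ℚ⟮β⟯) = q * q.den := by exact_mod_cast (Rat.mul_den_eq_num q).symm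
    rw [this, map_mul]
    exact (mul_le_of_le_one_left' h1).trans_lt hden
  have hnum' : (q.num : 𝓞 ℚ⟮β⟯) ∈ P := by
    refine (v.valuation_lt_one_iff_mem (K := ℚ⟮β⟯) (q.num : 𝓞 ℚ⟮β⟯)).1 ?_
    have h3 : v.valuation ℚ⟮β⟯ (algebraMap (𝓞 ℚ⟮β⟯) ℚ⟮β⟯ q.num) < 1 := by rwa [map_intCast]
    exact h3
  have hnum'' : q.num ∈ P.under ℤ := by simpa [Ideal.under] using hnum'
  rw [hPp, Ideal.mem_span_singleton] at hnum''
  have h2 : p ∣ Nat.gcd q.num.natAbs q.den :=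
    Nat.dvd_gcd (Int.natCast_dvd.1 hnum'') hpd
  rw [q.reduced] at h2
  exact hp.one_lt.ne' (Nat.dvd_one.1 h2)

/-- An element is integral as soon as its product with a power of `β` is integral and it is
integral at the primes containing `β`. -/
theorem isIntegral_of_mul_pow [IsPisot β] {x : ℚ⟮β⟯} (j : ℕ) (h1 : IsIntegral ℤ (gen β ^ j * x))
    (h2 : ∀ P : Primes β, P.1.valuation ℚ⟮β⟯ x ≤ 1) : IsIntegral ℤ x := by
  obtain ⟨y, rfl⟩ := HeightOneSpectrum.mem_integers_of_valuation_le_one (R := 𝓞 ℚ⟮β⟯) ℚ⟮β⟯ x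
    fun v => by
      by_cases hv : genInt β ∈ v.asIdeal
      · exact h2 ⟨v, hv⟩
      · have h3 : v.valuation ℚ⟮β⟯ (gen β) = 1 :=
          (v.valuation_eq_one_iff_notMem (K := ℚ⟮β⟯) (r := genInt β)).2 hv
        have h4 := valuation_le_one_of_isIntegral v h1
        rwa [map_mul, map_pow, h3, one_pow, one_mul] at h4
  exact y.2

/-! ### Topology of the representation space -/

variable (β) in
/-- The embedding `φ_∞` as a ring homomorphism. -/
noncomputable def phiInfHom : ℚ⟮β⟯ →+* KInf β :=
  (RingHom.pi fun w => InfinitePlace.embedding_of_isReal w.2.1).prod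
    (RingHom.pi fun w => w.1.embedding)

variable (β) in
/-- The embedding `φ_f` as a ring homomorphism. -/
noncomputable def phiFinHom [IsPisot β] : ℚ⟮β⟯ →+* KFin β :=
  RingHom.pi fun P => algebraMap ℚ⟮β⟯ (P.1.adicCompletion ℚ⟮β⟯)

variable (β) in
/-- The embedding `φ_β` as a ring homomorphism. -/
noncomputable def phiBetaHom [IsPisot β] : ℚ⟮β⟯ →+* KBeta β := (phiInfHom β).prod (phiFinHom β)

theorem phiFinHom_apply [IsPisot β] (x : ℚ⟮β⟯) : phiFinHom β x = phiFin β x := rfl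

theorem phiBeta_ratCast [IsPisot β] (q : ℚ) :
    phiBeta β (q : ℚ⟮β⟯) = (diag β q, phiFin β (q : ℚ⟮β⟯)) := by
  refine Prod.ext (Prod.ext ?_ ?_) rfl
  · funext w
    exact map_ratCast (InfinitePlace.embedding_of_isReal w.2.1) q
  · funext w
    refine (map_ratCast w.1.embedding q).trans ?_
    simp [diag]

theorem continuous_diag : Continuous (diag β) := by
  unfold diag
  fun_prop

theorem stdEmb_isReal : ComplexEmbedding.IsReal (stdEmb β) := by
  refine RingHom.ext fun x => ?_
  rw [ComplexEmbedding.conjugate_coe_eq, stdEmb_apply, Complex.conj_ofReal]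

theorem stdPlace_isReal : (stdPlace β).IsReal := InfinitePlace.isReal_mk_iff.2 stdEmb_isReal

theorem mk_ne_stdPlace {σ : ℚ⟮β⟯ →+* ℂ} (hσ : σ ≠ stdEmb β) : InfinitePlace.mk σ ≠ stdPlace β := by
  intro h
  rcases InfinitePlace.mk_eq_iff.1 h with h | h
  · exact hσ h
  · have h1 : ComplexEmbedding.conjugate (ComplexEmbedding.conjugate σ) =
      ComplexEmbedding.conjugate (stdEmb β) := congrArg _ h
    exact hσ ((star_star σ).symm.trans (h1.trans stdEmb_isReal))

theorem embedding_ne_stdEmb {w : InfinitePlace ℚ⟮β⟯} (hw : w ≠ stdPlace β) :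
    w.embedding ≠ stdEmb β := by
  intro h
  apply hw
  rw [← InfinitePlace.mk_embedding w, h]
  rfl

theorem valued_algebraMap [IsPisot β] (P : HeightOneSpectrum (𝓞 ℚ⟮β⟯)) (x : ℚ⟮β⟯) :
    Valued.v (algebraMap ℚ⟮β⟯ (P.adicCompletion ℚ⟮β⟯) x) = P.valuation ℚ⟮β⟯ x :=
  HeightOneSpectrum.valuedAdicCompletion_eq_valuation' P x

/-- Multiplication by `β` contracts every factor of `𝕂_β`: the only Archimedean place where it
expands is left out, and the finite places kept are those where `β` has positive valuation. -/
theorem tendsto_phiBetaHom_pow [IsPisot β] :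
    Tendsto (fun k : ℕ => phiBetaHom β (gen β ^ k)) atTop (𝓝 0) := by
  have hinf : ∀ w : InfinitePlace ℚ⟮β⟯, w ≠ stdPlace β → ‖w.embedding (gen β)‖ < 1 :=
    fun w hw => norm_conj_gen_lt_one (embedding_ne_stdEmb hw)
  simp only [map_pow]
  refine Prod.tendsto_iff _ _ |>.2 ⟨Prod.tendsto_iff _ _ |>.2 ⟨?_, ?_⟩, ?_⟩
  · refine tendsto_pi_nhds.2 fun w => tendsto_pow_atTop_nhds_zero_of_norm_lt_one ?_
    have h := hinf w.1 w.2.2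
    rwa [← InfinitePlace.embedding_of_isReal_apply w.2.1, Complex.norm_real] at h
  · refine tendsto_pi_nhds.2 fun w => tendsto_pow_atTop_nhds_zero_of_norm_lt_one ?_
    refine hinf w.1 fun h => ?_
    have h1 := w.2
    rw [h] at h1
    exact InfinitePlace.not_isReal_iff_isComplex.2 h1 stdPlace_isReal
  · refine tendsto_pi_nhds.2 fun P => Valued.tendsto_zero_pow_of_v_lt_one ?_
    exact (valued_algebraMap P.1 (gen β)).trans_lt (valuation_gen_lt_one P)

/-- The origin of the sign in `-T̃`: the elements `x (β^(hk) - 1)` approximate `-x` in `𝕂_β`. -/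
theorem tendsto_phiBetaHom_mul_pow_sub_one [IsPisot β] (x : ℚ⟮β⟯) {h : ℕ} (hh : 0 < h) :
    Tendsto (fun k : ℕ => phiBetaHom β (x * (gen β ^ (h * k) - 1))) atTop
      (𝓝 (-phiBetaHom β x)) := by
  have h1 : Tendsto (fun k : ℕ => h * k) atTop atTop :=
    tendsto_id.const_mul_atTop' hh
  have h2 := ((tendsto_phiBetaHom_pow (β := β)).comp h1).sub_const 1 |>.const_mul (phiBetaHom β x)
  simpa using h2

/-- Convergence to zero in `𝕂_β` controls all conjugates and all valuations. -/
theorem eventually_norm_conj_le [IsPisot β] {ι : Type*} {l : Filter ι} {f : ι → ℚ⟮β⟯}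
    (hf : Tendsto (fun i => phiBetaHom β (f i)) l (𝓝 0)) {σ : ℚ⟮β⟯ →+* ℂ} (hσ : σ ≠ stdEmb β)
    {ε : ℝ} (hε : 0 < ε) : ∀ᶠ i in l, ‖σ (f i)‖ ≤ ε := by
  have h1 := ((Prod.tendsto_iff _ _).1 hf).1
  have key : Tendsto (fun i => ‖(InfinitePlace.mk σ).embedding (f i)‖) l (𝓝 0) := by
    rcases InfinitePlace.isReal_or_isComplex (InfinitePlace.mk σ) with hr | hc
    · have h2 := tendsto_pi_nhds.1 ((Prod.tendsto_iff _ _).1 h1).1 ⟨_, hr, mk_ne_stdPlace hσ⟩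
      have h3 := h2.norm
      refine Tendsto.congr (fun i => ?_) (by simpa using h3)
      rw [← InfinitePlace.embedding_of_isReal_apply hr, Complex.norm_real]
      rfl
    · have h2 := tendsto_pi_nhds.1 ((Prod.tendsto_iff _ _).1 h1).2 ⟨_, hc⟩
      have h3 : Tendsto (fun i => ‖(InfinitePlace.mk σ).embedding (f i)‖) l (𝓝 ‖(0 : ℂ)‖) := h2.norm
      rwa [norm_zero] at h3
  filter_upwards [key.eventually (eventually_le_nhds hε)] with i hi
  rwa [InfinitePlace.norm_embedding_eq, InfinitePlace.apply] at hi

theorem eventually_valuation_le [IsPisot β] {ι : Type*} {l : Filter ι} {f : ι → ℚ⟮β⟯}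
    (hf : Tendsto (fun i => phiBetaHom β (f i)) l (𝓝 0)) (P : Primes β) {c : ℚ⟮β⟯} (hc : c ≠ 0) :
    ∀ᶠ i in l, P.1.valuation ℚ⟮β⟯ (f i) ≤ P.1.valuation ℚ⟮β⟯ c := by
  have h1 : Tendsto (fun i => algebraMap ℚ⟮β⟯ (P.1.adicCompletion ℚ⟮β⟯) (f i)) l (𝓝 0) :=
    tendsto_pi_nhds.1 ((Prod.tendsto_iff _ _).1 hf).2 P
  have hc' : algebraMap ℚ⟮β⟯ (P.1.adicCompletion ℚ⟮β⟯) c ≠ 0 := by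
    rwa [Ne, map_eq_zero]
  have h2 : {y | Valued.v.restrict y <
      Valued.v.restrict (algebraMap ℚ⟮β⟯ (P.1.adicCompletion ℚ⟮β⟯) c)} ∈ 𝓝 0 :=
    Valued.mem_nhds_zero.2 ⟨Units.mk0 _ ((Valuation.ne_zero_iff _).2 hc'), fun y hy => hy⟩
  filter_upwards [h1 h2] with i hi
  have h3 := (Valuation.restrict_lt_iff _).1 hi
  rw [valued_algebraMap, valued_algebraMap] at h3
  exact h3.le

/-- Small multiples of `N(β)^k` are close to zero in the completions. -/
theorem exists_forall_restrict_lt [IsPisot β] (P : Primes β)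
    (γ : (MonoidWithZeroHom.ValueGroup₀ (.ofClass
      (Valued.v : Valuation (P.1.adicCompletion ℚ⟮β⟯) (WithZero (Multiplicative ℤ)))))ˣ) :
    ∃ k : ℕ, ∀ e ∈ ZN β, Valued.v.restrict (algebraMap ℚ⟮β⟯ (P.1.adicCompletion ℚ⟮β⟯)
      ((absNorm β ^ k * e : ℚ) : ℚ⟮β⟯)) < γ := by
  have h1 : Tendsto (fun k : ℕ => (algebraMap ℚ⟮β⟯ (P.1.adicCompletion ℚ⟮β⟯) (absNorm β)) ^ k)
      atTop (𝓝 0) := by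
    refine Valued.tendsto_zero_pow_of_v_lt_one ?_
    rw [valued_algebraMap]
    exact valuation_absNorm_lt_one P
  have h2 : {y | Valued.v.restrict y < (γ : MonoidWithZeroHom.ValueGroup₀ (.ofClass
      (Valued.v : Valuation (P.1.adicCompletion ℚ⟮β⟯) (WithZero (Multiplicative ℤ)))))} ∈ 𝓝 0 :=
    Valued.mem_nhds_zero.2 ⟨γ, fun y hy => hy⟩
  obtain ⟨k, hk⟩ := (h1.eventually h2).exists
  refine ⟨k, fun e he => lt_of_le_of_lt ?_ hk⟩
  rw [Valuation.restrict_le_iff, ← map_pow, valued_algebraMap, valued_algebraMap]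
  push_cast
  rw [map_mul]
  exact mul_le_of_le_one_right' (valuation_le_one_of_mem_ZN P he)

theorem tendsto_phiFin_zero [IsPisot β] {ι : Type*} {l : Filter ι} {f : ι → ℚ}
    (hf : ∀ k : ℕ, ∀ᶠ i in l, ∃ e ∈ ZN β, f i = absNorm β ^ k * e) :
    Tendsto (fun i => phiFin β (f i : ℚ⟮β⟯)) l (𝓝 0) := by
  refine tendsto_pi_nhds.2 fun P => ?_
  refine tendsto_def.2 fun s hs => ?_
  obtain ⟨γ, hγ⟩ := Valued.mem_nhds_zero.1 hs
  obtain ⟨k, hk⟩ := exists_forall_restrict_lt P γ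
  filter_upwards [hf k] with i hi
  obtain ⟨e, he, hfe⟩ := hi
  refine hγ ?_
  have := hk e he
  rw [← hfe] at this
  exact this

/-- The closure of `φ_f(ℤ_(N(β)))` is compact, in terms of ultrafilters. -/
theorem exists_tendsto_phiFin [IsPisot β] (U : Ultrafilter ℚ) (hU : ZN β ∈ U) :
    ∃ z ∈ closZN β, Tendsto (fun q : ℚ => phiFin β (q : ℚ⟮β⟯)) U (𝓝 z) := by
  have hk : ∀ k : ℕ, ∃ i : ℕ, ∀ᶠ q in (U : Filter ℚ), ∃ e ∈ ZN β, q - i = absNorm β ^ k * e := by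
    intro k
    have h1 : (⋃ i ∈ Set.Iio (absNorm β ^ k), {q : ℚ | ∃ e ∈ ZN β, q - (i : ℕ) = absNorm β ^ k * e})
        ∈ U := by
      filter_upwards [hU] with q hq
      obtain ⟨i, hi, he⟩ := exists_sub_natCast_eq k hq
      exact Set.mem_biUnion hi he
    obtain ⟨i, -, hi⟩ := (Ultrafilter.finite_biUnion_mem_iff (Set.finite_Iio _)).1 h1
    exact ⟨i, hi⟩
  have hc : ∀ P : Primes β, ∃ z, Tendsto
      (fun q : ℚ => algebraMap ℚ⟮β⟯ (P.1.adicCompletion ℚ⟮β⟯) (q : ℚ⟮β⟯)) U (𝓝 z) := by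
    intro P
    have hC : Cauchy (map (fun q : ℚ => algebraMap ℚ⟮β⟯ (P.1.adicCompletion ℚ⟮β⟯) (q : ℚ⟮β⟯))
        (U : Filter ℚ)) := by
      refine Valued.cauchy_iff.2 ⟨inferInstance, fun γ => ?_⟩
      -- The ultrafilter concentrates on one residue class modulo `N(β)^k`, and two members of a
      -- class differ by a multiple of `N(β)^k`, which is small at `P`.
      obtain ⟨k, hkγ⟩ := exists_forall_restrict_lt P γ
      obtain ⟨i, hi⟩ := hk k
      refine ⟨_, image_mem_map hi, ?_⟩
      rintro _ ⟨q, ⟨e, he, hq⟩, rfl⟩ _ ⟨r, ⟨e', he', hr⟩, rfl⟩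
      have h1 := hkγ (e' - e) (sub_mem_ZN he' he)
      have h2 : (absNorm β : ℚ) ^ k * (e' - e) = r - q := by
        rw [mul_sub, ← hq, ← hr]; ring
      rw [h2, Rat.cast_sub, map_sub] at h1
      exact h1
    exact CompleteSpace.complete hC
  choose z hz using hc
  have ht : Tendsto (fun q : ℚ => phiFin β (q : ℚ⟮β⟯)) U (𝓝 z) := tendsto_pi_nhds.2 hz
  refine ⟨z, mem_closure_of_tendsto ht ?_, ht⟩
  filter_upwards [hU] with q hq
  exact Set.mem_image_of_mem _ hq

/-- Points of `ℝ × closure φ_f(ℤ_(N(β)))` are limits of elements of `ℤ_(N(β))` lying in any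
prescribed intervals accumulating at the real coordinate. -/
theorem exists_ultrafilter_tendsto [IsPisot β] {e : ℝ} {I : Set ℝ}
    (hI : ∀ ε > 0, ∃ a b : ℝ, a < b ∧ Set.Ioo a b ⊆ I ∩ Metric.ball e ε)
    {z : KFin β} (hz : z ∈ closZN β) :
    ∃ U : Ultrafilter ℚ, ZN β ∈ U ∧ (∀ᶠ q : ℚ in (U : Filter ℚ), (q : ℝ) ∈ I) ∧
      Tendsto (fun q : ℚ => ((q : ℝ), phiFin β (q : ℚ⟮β⟯))) U (𝓝 (e, z)) := by
  let F : ℚ → ℝ × KFin β := fun q => ((q : ℝ), phiFin β (q : ℚ⟮β⟯))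
  let S : Set ℚ := {q | q ∈ ZN β ∧ (q : ℝ) ∈ I}
  have hcl : ∀ q ∈ ZN β, (e, phiFin β (q : ℚ⟮β⟯)) ∈ closure (F '' S) := by
    intro q hq
    have hex : ∀ k : ℕ, ∃ r ∈ S, (∃ c ∈ ZN β, r - q = absNorm β ^ k * c) ∧
        |(r : ℝ) - e| < 1 / ((k : ℝ) + 1) := by
      intro k
      obtain ⟨a, b, hab, hsub⟩ := hI (1 / ((k : ℝ) + 1)) Nat.one_div_pos_of_nat
      -- Perturbing `q` by a multiple of `N(β)^k` brings the real coordinate close to `e` while the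
      -- finite coordinates stay close to those of `q`.
      obtain ⟨c, hc, h1, h2⟩ := exists_mem_ZN_between (β := β) k
        (show a - q < b - q by linarith)
      have hmem : ((q + absNorm β ^ k * c : ℚ) : ℝ) ∈ Set.Ioo a b := by
        rw [Rat.cast_add]
        constructor <;> linarith
      have hZ : q + absNorm β ^ k * c ∈ ZN β := by
        have h3 : (absNorm β : ℚ) ^ k ∈ ZN β := by
          exact_mod_cast natCast_mem_ZN (β := β) (absNorm β ^ k)
        have h4 := sub_mem_ZN hq (sub_mem_ZN (natCast_mem_ZN 0) (mul_mem_ZN h3 hc))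
        simpa using h4
      refine ⟨_, ⟨hZ, (hsub hmem).1⟩, ⟨c, hc, by ring⟩, ?_⟩
      have := (hsub hmem).2
      rwa [Metric.mem_ball, Real.dist_eq] at this
    choose r hrS hr hrlt using hex
    have h1 : Tendsto (fun k => (r k : ℝ)) atTop (𝓝 e) := by
      rw [tendsto_iff_dist_tendsto_zero]
      refine squeeze_zero (fun _ => dist_nonneg) (fun k => ?_)
        tendsto_one_div_add_atTop_nhds_zero_nat
      rw [Real.dist_eq]
      exact (hrlt k).le
    have h2 : Tendsto (fun k => phiFin β ((r k - q : ℚ) : ℚ⟮β⟯)) atTop (𝓝 0) := by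
      refine tendsto_phiFin_zero fun k => ?_
      filter_upwards [eventually_ge_atTop k] with j hj
      obtain ⟨c, hc, hjc⟩ := hr j
      have h3 : (absNorm β : ℚ) ^ (j - k) ∈ ZN β := by
        exact_mod_cast natCast_mem_ZN (β := β) (absNorm β ^ (j - k))
      refine ⟨absNorm β ^ (j - k) * c, mul_mem_ZN h3 hc, ?_⟩
      rw [hjc, ← mul_assoc, ← pow_add, Nat.add_sub_cancel' hj]
    have h3 : Tendsto (fun k => phiFin β (r k : ℚ⟮β⟯)) atTop (𝓝 (phiFin β (q : ℚ⟮β⟯))) := by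
      have h4 := h2.add_const (phiFin β (q : ℚ⟮β⟯))
      rw [zero_add] at h4
      refine h4.congr fun k => ?_
      rw [← phiFinHom_apply, ← phiFinHom_apply, ← map_add, phiFinHom_apply]
      congr 1
      push_cast
      ring
    exact mem_closure_of_tendsto (h1.prodMk_nhds h3)
      (Eventually.of_forall fun k => Set.mem_image_of_mem F (hrS k))
  have hmem : (e, z) ∈ closure (F '' S) := by
    have h1 : closZN β ⊆ (fun y : KFin β => (e, y)) ⁻¹' closure (F '' S) := by
      refine closure_minimal ?_ (isClosed_closure.preimage (by fun_prop))
      rintro _ ⟨q, hq, rfl⟩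
      exact hcl q hq
    exact h1 hz
  rw [mem_closure_iff_clusterPt, ← map_principal] at hmem
  obtain ⟨U, hU, ht⟩ := mapClusterPt_iff_ultrafilter.1 hmem
  have hUS : S ∈ U := le_principal_iff.1 hU
  refine ⟨U, ?_, ?_, ht⟩
  · filter_upwards [hUS] with q hq using hq.1
  · filter_upwards [hUS] with q hq using hq.2

/-! ### Tiles and purely periodic expansions -/

/-- Divide the monic integral equation of degree `n` by `β^(n-1)`. -/
theorem gen_mem_adjoin_inv [IsPisot β] : gen β ∈ Algebra.adjoin ℤ {(gen β)⁻¹} := by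
  set A := Algebra.adjoin ℤ {(gen β)⁻¹}
  have hinv : (gen β)⁻¹ ∈ A := Algebra.self_mem_adjoin_singleton _ _
  have hg := gen_ne_zero (β := β)
  obtain ⟨P, hP, hP0⟩ := gen_isIntegral β
  have h0 : 0 < P.natDegree := by
    rw [Nat.pos_iff_ne_zero]
    intro h
    rw [hP.natDegree_eq_zero.1 h, Polynomial.eval₂_one] at hP0
    exact one_ne_zero hP0
  rw [Polynomial.eval₂_eq_sum_range, Finset.sum_range_succ, hP.coeff_natDegree, map_one,
    one_mul] at hP0
  have h1 : gen β ^ P.natDegree = gen β * gen β ^ (P.natDegree - 1) := by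
    rw [← pow_succ', Nat.sub_add_cancel h0]
  have h2 : gen β = -∑ i ∈ Finset.range P.natDegree,
      algebraMap ℤ ℚ⟮β⟯ (P.coeff i) * (gen β)⁻¹ ^ (P.natDegree - 1 - i) := by
    have h3 : gen β = gen β ^ P.natDegree * (gen β)⁻¹ ^ (P.natDegree - 1) := by
      rw [h1, mul_assoc, ← mul_pow, mul_inv_cancel₀ hg, one_pow, mul_one]
    have h4 : gen β ^ P.natDegree = -∑ i ∈ Finset.range P.natDegree,
        algebraMap ℤ ℚ⟮β⟯ (P.coeff i) * gen β ^ i := eq_neg_of_add_eq_zero_right hP0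
    refine h3.trans ?_
    rw [h4, neg_mul, Finset.sum_mul]
    congr 1
    refine Finset.sum_congr rfl fun i hi => ?_
    have hi' : i ≤ P.natDegree - 1 := Nat.le_sub_one_of_lt (Finset.mem_range.1 hi)
    obtain ⟨j, hj⟩ := Nat.exists_eq_add_of_le hi'
    rw [hj, Nat.add_sub_cancel_left, pow_add, mul_assoc, ← mul_assoc (gen β ^ i), ← mul_pow,
      mul_inv_cancel₀ hg, one_pow, one_mul]
  rw [h2]
  exact neg_mem (sum_mem fun i _ => mul_mem (algebraMap_mem _ _) (pow_mem hinv _))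

theorem adjoin_le_adjoin_inv [IsPisot β] :
    Algebra.adjoin ℤ {gen β} ≤ Algebra.adjoin ℤ {(gen β)⁻¹} :=
  Algebra.adjoin_le (Set.singleton_subset_iff.2 gen_mem_adjoin_inv)

/-- A purely periodic rational lies in the natural extension domain. -/
theorem exists_subtile_of_purelyPeriodic [IsPisot β] {q : ℚ} (hq : q ∈ purelyPeriodic β) :
    ∃ a ∈ nodes β, (q : ℝ) < dval β (a - 1) ∧ -phiBeta β (q : ℚ⟮β⟯) ∈ subtile β a := by
  obtain ⟨h0, h1, p, hp, hT⟩ := mem_purelyPeriodic_iff.1 hq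
  have h0' : (0 : ℝ) ≤ q := by exact_mod_cast h0
  have h1' : (q : ℝ) < 1 := by exact_mod_cast h1
  have hfin : {a | a ∈ nodes β ∧ (q : ℝ) < dval β (a - 1)}.Finite :=
    nodes_finite.subset fun a ha => ha.1
  have hmem : -phiBetaHom β (q : ℚ⟮β⟯) ∈ closure (⋃ a ∈ {a | a ∈ nodes β ∧ (q : ℝ) < dval β (a - 1)},
      phiBeta β '' {x | ∃ w ∈ lang β a, x = Nat.ofDigits (gen β) w.reverse}) := by
    refine mem_closure_of_tendsto (tendsto_phiBetaHom_mul_pow_sub_one (q : ℚ⟮β⟯) hp)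
      (Eventually.of_forall fun k => ?_)
    -- After `pk` digits the remainder is `q` again, so the word read has value `q (β^(pk) - 1)` and
    -- ends at a node whose threshold exceeds `q`. Closure commutes with the finite union over such
    -- nodes.
    obtain ⟨w, a, hw, hlt, he⟩ := exists_conducts_of_expansion (β := β) h0' h1' (p * k)
    rw [iterate_mul_betaT hT] at hlt he
    refine Set.mem_biUnion (⟨hw.mem_nodes, hlt⟩ : a ∈ {a | a ∈ nodes β ∧ (q : ℝ) < dval β (a - 1)})
      ⟨_, ⟨w, mem_lang_iff.2 hw, ?_⟩, rfl⟩
    apply Subtype.ext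
    rw [coe_ofDigits_gen]
    push_cast
    rw [coe_gen]
    linarith
  rw [hfin.closure_biUnion] at hmem
  obtain ⟨a, ha, hmem⟩ := Set.mem_iUnion₂.1 hmem
  exact ⟨a, ha.1, ha.2, hmem⟩

variable (β) in
/-- The opposites of the images of the elements of `ℤ_(N(β)) ∩ [0,1]` are covered by finitely
many tiles. -/
theorem exists_finite_tiles [IsPisot β] : ∃ X : Set ℚ⟮β⟯, X.Finite ∧ X ⊆ fracIndex β ∧
    ∀ q ∈ ZN β, 0 ≤ q → q ≤ 1 → (∃ a ∈ nodes β, -phiBeta β (q : ℚ⟮β⟯) ∈ subtile β a) ∨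
      ∃ x ∈ X, -phiBeta β (q : ℚ⟮β⟯) ∈ tile β x := by
  obtain ⟨C, hC0, hC⟩ := exists_conj_bound β
  let X := {x : ℚ⟮β⟯ | IsIntegral ℤ (((1 : ℕ) : ℚ⟮β⟯) * x) ∧ |(x : ℝ)| ≤ 2 + C ∧
    ∀ σ : ℚ⟮β⟯ →+* ℂ, σ ≠ stdEmb β → ‖σ x‖ ≤ 2 + C} ∩ fracIndex β
  have hX : X.Finite := (finite_bounded_conj β 1 one_ne_zero (2 + C)).inter_of_left _
  refine ⟨X, hX, Set.inter_subset_right, fun q hq h0 h1 => ?_⟩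
  have h0' : (0 : ℝ) ≤ q := by exact_mod_cast h0
  have h1' : (q : ℝ) ≤ 1 := by exact_mod_cast h1
  obtain ⟨h, hh, m, hm, hgm⟩ := exists_pow_gen_sub_one q.den_nz hq
  have hmem : -phiBetaHom β (q : ℚ⟮β⟯) ∈ closure ((⋃ a ∈ nodes β,
      phiBeta β '' {x | ∃ w ∈ lang β a, x = Nat.ofDigits (gen β) w.reverse}) ∪
      ⋃ x ∈ X, phiBeta β '' {y | 0 ≤ (y : ℝ) ∧ fracPart β (y : ℝ) = (x : ℝ)}) := by
    refine mem_closure_of_tendsto (tendsto_phiBetaHom_mul_pow_sub_one (q : ℚ⟮β⟯) hh)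
      (Eventually.of_forall fun k => ?_)
    -- The denominator of `q` divides `β^h - 1` in `ℤ[β]`, so `y` lies in `ℤ[β]`. Its other
    -- conjugates are at most 2 and those of its integer part at most `C`, uniformly in `k`; hence
    -- its fractional part, when nonzero, lies in the finite set `X`.
    set y : ℚ⟮β⟯ := q * (gen β ^ (h * k) - 1) with hydef
    have hy : y ∈ Algebra.adjoin ℤ {gen β} := by
      have h2 : y = q.num * m * ∑ i ∈ Finset.range k, (gen β ^ h) ^ i := by
        have h3 : (q : ℚ⟮β⟯) * q.den = q.num := by exact_mod_cast Rat.mul_den_eq_num q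
        rw [hydef, pow_mul, ← geom_sum_mul, hgm, ← h3]
        ring
      rw [h2]
      exact mul_mem (mul_mem (intCast_mem _ _) hm)
        (sum_mem fun i _ => pow_mem (pow_mem (Algebra.self_mem_adjoin_singleton _ _) _) _)
    have hy0 : 0 ≤ (y : ℝ) := by
      rw [hydef]
      push_cast
      rw [coe_gen]
      exact mul_nonneg h0' (sub_nonneg.2 (one_le_pow₀ (IsPisot.one_lt (β := β)).le))
    have hyσ : ∀ σ : ℚ⟮β⟯ →+* ℂ, σ ≠ stdEmb β → ‖σ y‖ ≤ 2 := by
      intro σ hσ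
      rw [hydef, map_mul, map_sub, map_pow, map_one, map_ratCast, norm_mul]
      have h2 : ‖((q : ℚ) : ℂ)‖ ≤ 1 := by
        rw [← Complex.ofReal_ratCast, Complex.norm_real, Real.norm_of_nonneg h0']
        exact h1'
      have h3 : ‖σ (gen β) ^ (h * k) - 1‖ ≤ 2 := by
        refine (norm_sub_le _ _).trans ?_
        rw [norm_pow, norm_one]
        linarith [pow_le_one₀ (n := h * k) (norm_nonneg _) (norm_conj_gen_lt_one hσ).le]
      calc _ ≤ 1 * (2 : ℝ) := mul_le_mul h2 h3 (norm_nonneg _) zero_le_one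
        _ = 2 := one_mul _
    obtain ⟨w, a, hw, he, hf0, hf1⟩ := exists_conducts_add_fracPart (β := β) hy0
    -- The value 0 is excluded from `fracIndex`: it means that `y` is a `β`-integer, covered by the
    -- central subtiles.
    rcases hf0.eq_or_lt with hf | hf
    · refine Or.inl (Set.mem_biUnion hw.mem_nodes ⟨_, ⟨w, mem_lang_iff.2 hw, ?_⟩, rfl⟩)
      apply Subtype.ext
      rw [coe_ofDigits_gen]
      linarith
    · have hx : ((y - Nat.ofDigits (gen β) w.reverse : ℚ⟮β⟯) : ℝ) = fracPart β (y : ℝ) := by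
        push_cast
        rw [coe_ofDigits_gen]
        linarith
      have hxmem : y - Nat.ofDigits (gen β) w.reverse ∈ Algebra.adjoin ℤ {gen β} :=
        sub_mem hy (ofDigits_gen_mem _)
      refine Or.inr (Set.mem_biUnion (x := y - Nat.ofDigits (gen β) w.reverse)
        ⟨⟨?_, ?_, fun σ hσ => ?_⟩, adjoin_le_adjoin_inv hxmem, ?_, ?_⟩ ⟨y, ⟨hy0, hx.symm⟩, rfl⟩)
      · simpa using isIntegral_of_mem_adjoin hxmem
      · rw [hx, abs_of_nonneg hf0]
        linarith
      · rw [map_sub]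
        exact (norm_sub_le _ _).trans (add_le_add (hyσ σ hσ) (hw.norm_conj_le hC0 hC hσ))
      · rw [hx]; exact hf
      · rw [hx]; exact hf1
  rw [closure_union, nodes_finite.closure_biUnion, hX.closure_biUnion] at hmem
  rcases hmem with hmem | hmem
  · obtain ⟨a, ha, hmem⟩ := Set.mem_iUnion₂.1 hmem
    exact Or.inl ⟨a, ha, hmem⟩
  · obtain ⟨x, hx, hmem⟩ := Set.mem_iUnion₂.1 hmem
    exact Or.inr ⟨x, hx, hmem⟩

theorem ofDigits_append_zero {R : Type*} [Semiring R] (r : R) (w : List ℕ) :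
    Nat.ofDigits r (w ++ [0]) = Nat.ofDigits r w := by
  induction w with
  | nil => simp [ofDigits_nil', ofDigits_cons']
  | cons a w ih => rw [List.cons_append, ofDigits_cons', ofDigits_cons', ih]

theorem ofDigits_reverse_replicate_zero_append {R : Type*} [Semiring R] (r : R) (w : List ℕ)
    (j : ℕ) : Nat.ofDigits r (List.replicate j 0 ++ w).reverse = Nat.ofDigits r w.reverse := by
  induction j with
  | zero => rfl
  | succ j ih =>
    rw [List.replicate_succ, List.cons_append, List.reverse_cons, ofDigits_append_zero, ih]

/-- A rational of the natural extension domain is purely periodic. -/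
theorem purelyPeriodic_of_mem_subtile [IsPisot β] {q : ℚ} {a : ℕ} (h0 : 0 ≤ q)
    (hlt : (q : ℝ) < dval β (a - 1)) (hq : -phiBeta β (q : ℚ⟮β⟯) ∈ subtile β a) :
    q ∈ purelyPeriodic β := by
  have h0' : (0 : ℝ) ≤ q := by exact_mod_cast h0
  have h1' : (q : ℝ) < 1 := hlt.trans_le (dval_le_one _)
  have hβ := pisot_pos (β := β)
  refine mem_purelyPeriodic_iff.2 ⟨h0, by exact_mod_cast h1', ?_⟩
  obtain ⟨C, hC0, hC⟩ := exists_conj_bound β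
  have hF := finite_bounded_conj β q.den q.den_nz (1 + C)
  set F := {x : ℚ⟮β⟯ | IsIntegral ℤ ((q.den : ℚ⟮β⟯) * x) ∧ |(x : ℝ)| ≤ 1 + C ∧
      ∀ σ : ℚ⟮β⟯ →+* ℂ, σ ≠ stdEmb β → ‖σ x‖ ≤ 1 + C}
  -- The last `j + 1` points of an orbit ending at `q` will be shown to lie in `F`, which has only
  -- `j` elements.
  let j := hF.toFinset.card
  rw [subtile, mem_closure_iff_clusterPt, ← map_principal] at hq
  obtain ⟨U, hU, ht⟩ := mapClusterPt_iff_ultrafilter.1 hq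
  have ht' : Tendsto (fun y => phiBetaHom β (y + (q : ℚ⟮β⟯))) U (𝓝 0) := by
    have h2 := ht.add_const (phiBeta β (q : ℚ⟮β⟯))
    rw [neg_add_cancel] at h2
    exact h2.congr fun y => (map_add (phiBetaHom β) _ _).symm
  -- The `β`-integer `y` is taken so close to `-q` that `(y + q) / β^i`, for `i ≤ j`, still has
  -- conjugates at most 1 and valuations at most 1 at the primes containing `β`.
  have hev1 : ∀ᶠ y in (U : Filter ℚ⟮β⟯), ∀ σ : ℚ⟮β⟯ →+* ℂ, σ ≠ stdEmb β →
      ‖σ (y + (q : ℚ⟮β⟯))‖ ≤ ‖σ (gen β)‖ ^ j := by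
    refine eventually_all.2 fun σ => ?_
    by_cases hσ : σ = stdEmb β
    · exact Eventually.of_forall fun y h => absurd hσ h
    · have hpos : 0 < ‖σ (gen β)‖ ^ j :=
        pow_pos (norm_pos_iff.2 ((map_ne_zero σ).2 gen_ne_zero)) j
      filter_upwards [eventually_norm_conj_le ht' hσ hpos] with y hy _ using hy
  have hev2 : ∀ᶠ y in (U : Filter ℚ⟮β⟯), ∀ P : Primes β,
      P.1.valuation ℚ⟮β⟯ (y + (q : ℚ⟮β⟯)) ≤ P.1.valuation ℚ⟮β⟯ (gen β ^ j) :=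
    eventually_all.2 fun P => eventually_valuation_le ht' P (pow_ne_zero j gen_ne_zero)
  obtain ⟨y, ⟨hyσ, hyP⟩, w, hw, rfl⟩ :=
    ((hev1.and hev2).and (le_principal_iff.1 hU)).exists
  -- Padding makes the word at least `j` letters long, so that `j` steps backwards from `q` are
  -- available.
  have hW := (mem_lang_iff.1 hw).replicate_zero_append j
  set W := List.replicate j 0 ++ w with hWdef
  obtain ⟨s, hs0, hs1, hsT, hsW, -⟩ := hW.exists_prefix h0' hlt
  have hWlen : j ≤ W.length := by simp [hWdef]
  rw [hWdef, ofDigits_reverse_replicate_zero_append, ← hWdef] at hsW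
  set y : ℚ⟮β⟯ := Nat.ofDigits (gen β) w.reverse with hydef
  have hτ : ∀ i ≤ j, ∃ τ ∈ F, (τ : ℝ) = (betaT β)^[W.length - i] s := by
    intro i hi
    obtain ⟨V, b, hV, -, hVe⟩ := exists_conducts_of_expansion (β := β) hs0 hs1 (W.length - i)
    set v : ℚ⟮β⟯ := Nat.ofDigits (gen β) V.reverse with hvdef
    have hgi : gen β ^ i ≠ 0 := pow_ne_zero i gen_ne_zero
    -- From `β^|W| s = y + q`, removing the `β`-integer `v` spelled by the first `|W| - i` digits
    -- leaves the iterate reached `i` steps before `q`.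
    have hcoe : (((y + q) / gen β ^ i - v : ℚ⟮β⟯) : ℝ) = (betaT β)^[W.length - i] s := by
      have h2 : β ^ W.length = β ^ i * β ^ (W.length - i) := by
        rw [← pow_add, Nat.add_sub_cancel' (hi.trans hWlen)]
      rw [h2, mul_assoc, hVe] at hsW
      push_cast
      rw [hydef, hvdef, coe_ofDigits_gen, coe_ofDigits_gen, coe_gen, ← hsW,
        mul_div_cancel_left₀ _ (pow_pos hβ i).ne']
      ring
    refine ⟨(y + q) / gen β ^ i - v, ⟨?_, ?_, fun σ hσ => ?_⟩, hcoe⟩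
    · have hv : IsIntegral ℤ v := isIntegral_of_mem_adjoin (ofDigits_gen_mem _)
      have hy : IsIntegral ℤ y := isIntegral_of_mem_adjoin (ofDigits_gen_mem _)
      have hd : IsIntegral ℤ (q.den : ℚ⟮β⟯) := isIntegral_algebraMap (R := ℤ) (x := (q.den : ℤ))
      refine isIntegral_of_mul_pow i ?_ fun P => ?_
      · have h2 : gen β ^ i * (q.den * ((y + q) / gen β ^ i - v)) =
            q.den * y + q.num - q.den * gen β ^ i * v := by
          have h3 : (q : ℚ⟮β⟯) * q.den = q.num := by exact_mod_cast Rat.mul_den_eq_num q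
          rw [← h3]
          field_simp
        rw [h2]
        exact ((hd.mul hy).add (isIntegral_algebraMap (R := ℤ) (x := q.num))).sub
          ((hd.mul ((gen_isIntegral β).pow i)).mul hv)
      · rw [map_mul]
        refine mul_le_one' (valuation_le_one_of_isIntegral _ hd) ?_
        refine (Valuation.map_sub _ _ _).trans (max_le ?_ (valuation_le_one_of_isIntegral _ hv))
        rw [map_div₀]
        refine div_le_one_of_le₀ ((hyP P).trans ?_) zero_le
        rw [map_pow, map_pow]
        exact pow_le_pow_right_of_le_one' (valuation_gen_lt_one P).le hi
    · rw [hcoe, abs_of_nonneg (iterate_betaT_nonneg hs0 _)]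
      linarith [iterate_betaT_lt_one (β := β) hs1 (W.length - i)]
    · rw [map_sub, map_div₀, map_pow]
      refine (norm_sub_le _ _).trans (add_le_add ?_ (hV.norm_conj_le hC0 hC hσ))
      rw [norm_div, norm_pow]
      refine div_le_one_of_le₀ ((hyσ σ hσ).trans ?_) (pow_nonneg (norm_nonneg _) _)
      exact pow_le_pow_of_le_one (norm_nonneg _) (norm_conj_gen_lt_one hσ).le hi
  choose! τ hτF hτ using hτ
  obtain ⟨i₁, hi₁, i₂, hi₂, hne, heq⟩ := Finset.exists_ne_map_eq_of_card_lt_of_maps_to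
    (s := Finset.range (j + 1)) (t := hF.toFinset) (f := τ) (by simp [j])
    (fun i hi => by simpa using hτF i (Nat.lt_succ_iff.1 (Finset.mem_range.1 hi)))
  -- The coincidence occurs at or before the time the orbit reaches `q`. So `q` lies on the
  -- resulting cycle, and its expansion is purely rather than eventually periodic.
  have key : ∀ i k, i < k → k ≤ j → τ i = τ k → ∃ p, 0 < p ∧ (betaT β)^[p] (q : ℝ) = q := by
    intro i k hik hk he
    have h2 : (betaT β)^[W.length - i] s = (betaT β)^[W.length - k] s := by
      rw [← hτ i (hik.le.trans hk), ← hτ k hk, he]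
    refine ⟨k - i, by omega, ?_⟩
    have h3 : (q : ℝ) = (betaT β)^[i] ((betaT β)^[W.length - k] s) := by
      rw [← h2, ← Function.iterate_add_apply, Nat.add_sub_cancel' (by omega), hsT]
    have h4 : (betaT β)^[k - i] ((betaT β)^[W.length - k] s) = (betaT β)^[W.length - k] s := by
      rw [← Function.iterate_add_apply, ← h2]
      congr 2
      omega
    conv_lhs => rw [h3]
    rw [← Function.iterate_add_apply, add_comm, Function.iterate_add_apply, h4, ← h3]
  rw [Finset.mem_range, Nat.lt_succ_iff] at hi₁ hi₂
  rcases lt_or_gt_of_ne hne with h | h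
  · exact key i₁ i₂ h hi₂ heq
  · exact key i₂ i₁ h hi₁ heq.symm

/-! ### Endpoints of intervals of purely periodic rationals -/

theorem isIntegral_iterate_one [h : IsPisot β] (k : ℕ) : IsIntegral ℤ ((betaT β)^[k] 1) := by
  induction k with
  | zero => exact isIntegral_one
  | succ k ih =>
    have h1 := mul_iterate_betaT (β := β) zero_le_one k
    rw [← sub_eq_iff_eq_add'.2 h1]
    exact (h.isIntegral.mul ih).sub
      (isIntegral_algebraMap (R := ℤ) (A := ℝ) (x := (digit β 1 k : ℤ)))

/-- Iterates of 1 are algebraic integers, and no rational integer lies in `(0,1)`. This turns `e ≤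
T^(a-1)(1)`, which is all a limit provides, into a strict inequality for rational `e`. -/
theorem ratCast_ne_iterate_one [IsPisot β] {q : ℚ} (h0 : 0 < q) (h1 : q < 1) (k : ℕ) :
    (q : ℝ) ≠ (betaT β)^[k] 1 := by
  intro he
  have h2 : IsIntegral ℤ (algebraMap ℚ ℝ q) := by
    have := isIntegral_iterate_one (β := β) k
    rw [← he] at this
    exact this
  obtain ⟨n, hn⟩ := IsIntegrallyClosed.isIntegral_iff.1
    ((isIntegral_algebraMap_iff (algebraMap ℚ ℝ).injective).1 h2)
  rw [← hn, eq_intCast] at h0 h1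
  have h3 : (0 : ℤ) < n := by exact_mod_cast h0
  have h4 : n < (1 : ℤ) := by exact_mod_cast h1
  omega

/-- Points above an accumulation point of purely periodic rationals lie in the closure of the
natural extension domain. -/
theorem exists_subtile_of_accumulation [IsPisot β] {I : Set ℝ} {e : ℝ}
    (hper : ∀ q ∈ ZN β, (q : ℝ) ∈ I → q ∈ purelyPeriodic β)
    (hI : ∀ ε > 0, ∃ a b : ℝ, a < b ∧ Set.Ioo a b ⊆ I ∩ Metric.ball e ε)
    {z : KFin β} (hz : z ∈ closZN β) :
    ∃ a ∈ nodes β, ((diag β e, z) : KBeta β) ∈ -subtile β a ∧ e ≤ dval β (a - 1) := by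
  obtain ⟨U, hUZ, hUI, ht⟩ := exists_ultrafilter_tendsto hI hz
  have hcov : (⋃ a ∈ nodes β, {q : ℚ | (q : ℝ) < dval β (a - 1) ∧
      -phiBeta β (q : ℚ⟮β⟯) ∈ subtile β a}) ∈ U := by
    filter_upwards [hUZ, hUI] with q hq hqI
    obtain ⟨a, ha, h1, h2⟩ := exists_subtile_of_purelyPeriodic (hper q hq hqI)
    exact Set.mem_biUnion ha ⟨h1, h2⟩
  obtain ⟨a, ha, hUa⟩ := (Ultrafilter.finite_biUnion_mem_iff nodes_finite).1 hcov
  have ht1 : Tendsto (fun q : ℚ => (q : ℝ)) U (𝓝 e) := ((Prod.tendsto_iff _ _).1 ht).1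
  have ht2 : Tendsto (fun q : ℚ => phiFin β (q : ℚ⟮β⟯)) U (𝓝 z) := ((Prod.tendsto_iff _ _).1 ht).2
  have ht3 : Tendsto (fun q : ℚ => phiBeta β (q : ℚ⟮β⟯)) U (𝓝 (diag β e, z)) := by
    simp only [phiBeta_ratCast]
    exact ((continuous_diag.tendsto e).comp ht1).prodMk_nhds ht2
  refine ⟨a, ha, ?_, le_of_tendsto ht1 ?_⟩
  · rw [Set.mem_neg]
    refine isClosed_closure.mem_of_tendsto ht3.neg ?_
    filter_upwards [hUa] with q hq using hq.2
  · filter_upwards [hUa] with q hq using hq.1.le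

/-- Above an accumulation point of elements of `ℤ_(N(β))` that are not purely periodic, there is
a point of a tile outside the natural extension domain. -/
theorem exists_tile_of_accumulation [IsPisot β] {e : ℝ} (h0 : 0 < e) (h1 : e < 1)
    (hacc : ∀ ε > 0, ∃ q ∈ ZN β, q ∉ purelyPeriodic β ∧ |(q : ℝ) - e| < ε) :
    ∃ z ∈ closZN β,
      (∃ b ∈ nodes β, ((diag β e, z) : KBeta β) ∈ -subtile β b ∧ dval β (b - 1) ≤ e) ∨
      ∃ x ∈ fracIndex β, ((diag β e, z) : KBeta β) ∈ -tile β x := by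
  let S : Set ℚ := {q | q ∈ ZN β ∧ q ∉ purelyPeriodic β}
  have hcl : e ∈ closure ((fun q : ℚ => (q : ℝ)) '' S) := by
    refine Metric.mem_closure_iff.2 fun ε hε => ?_
    obtain ⟨q, hq, hqP, hlt⟩ := hacc ε hε
    refine ⟨q, ⟨q, ⟨hq, hqP⟩, rfl⟩, ?_⟩
    rwa [dist_comm, Real.dist_eq]
  rw [mem_closure_iff_clusterPt, ← map_principal] at hcl
  obtain ⟨U, hU, ht1⟩ := mapClusterPt_iff_ultrafilter.1 hcl
  have hUS : S ∈ U := le_principal_iff.1 hU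
  obtain ⟨z, hz, ht2⟩ := exists_tendsto_phiFin U (mem_of_superset hUS fun q hq => hq.1)
  have ht3 : Tendsto (fun q : ℚ => phiBeta β (q : ℚ⟮β⟯)) U (𝓝 (diag β e, z)) := by
    simp only [phiBeta_ratCast]
    exact ((continuous_diag.tendsto e).comp ht1).prodMk_nhds ht2
  obtain ⟨X, hX, hXsub, hcov⟩ := exists_finite_tiles β
  have hmem : (⋃ b ∈ nodes β, {q : ℚ | dval β (b - 1) ≤ (q : ℝ) ∧
      -phiBeta β (q : ℚ⟮β⟯) ∈ subtile β b}) ∪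
      (⋃ x ∈ X, {q : ℚ | -phiBeta β (q : ℚ⟮β⟯) ∈ tile β x}) ∈ U := by
    filter_upwards [hUS, ht1.eventually (eventually_gt_nhds h0),
      ht1.eventually (eventually_lt_nhds h1)] with q hq hq0 hq1
    have hq0' : 0 ≤ q := by exact_mod_cast hq0.le
    have hq1' : q ≤ 1 := by exact_mod_cast hq1.le
    rcases hcov q hq.1 hq0' hq1' with ⟨b, hb, hqb⟩ | ⟨x, hx, hqx⟩
    · refine Or.inl (Set.mem_biUnion hb ⟨?_, hqb⟩)
      -- Below the threshold of `b`, membership in the subtile would make `q` purely periodic.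
      by_contra! hlt
      exact hq.2 (purelyPeriodic_of_mem_subtile hq0' hlt hqb)
    · exact Or.inr (Set.mem_biUnion hx hqx)
  refine ⟨z, hz, ?_⟩
  rcases Ultrafilter.union_mem_iff.1 hmem with hmem | hmem
  · obtain ⟨b, hb, hUb⟩ := (Ultrafilter.finite_biUnion_mem_iff nodes_finite).1 hmem
    refine Or.inl ⟨b, hb, ?_, ge_of_tendsto ht1 ?_⟩
    · rw [Set.mem_neg]
      refine isClosed_closure.mem_of_tendsto ht3.neg ?_
      filter_upwards [hUb] with q hq using hq.2
    · filter_upwards [hUb] with q hq using hq.1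
  · obtain ⟨x, hx, hUx⟩ := (Ultrafilter.finite_biUnion_mem_iff hX).1 hmem
    refine Or.inr ⟨x, hXsub hx, ?_⟩
    rw [Set.mem_neg]
    exact isClosed_closure.mem_of_tendsto ht3.neg hUx

theorem purelyPeriodic_of_accumulation [IsPisot β] {I : Set ℝ} {q : ℚ} (h0 : 0 < q) (h1 : q < 1)
    (hq : q ∈ ZN β) (hper : ∀ q ∈ ZN β, (q : ℝ) ∈ I → q ∈ purelyPeriodic β)
    (hI : ∀ ε > 0, ∃ a b : ℝ, a < b ∧ Set.Ioo a b ⊆ I ∩ Metric.ball (q : ℝ) ε) :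
    q ∈ purelyPeriodic β := by
  obtain ⟨a, ha, hmem, hle⟩ := exists_subtile_of_accumulation hper hI
    (subset_closure (Set.mem_image_of_mem _ hq) : phiFin β (q : ℚ⟮β⟯) ∈ closZN β)
  rw [← phiBeta_ratCast] at hmem
  refine purelyPeriodic_of_mem_subtile h0.le (hle.lt_of_ne ?_) hmem
  rw [← dval_eq_iterate_of_mem_nodes ha]
  exact ratCast_ne_iterate_one h0 h1 _

/-- Non-periodic rationals supply one particular `z`. Periodic ones give a subtile above every `z`,
so both memberships can be asserted at the same point. Equality of `e` with the threshold of `a` is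
(A); otherwise the kind of second tile separates (B) from (C). -/
theorem cases_of_accumulation [IsPisot β] {I : Set ℝ} {e : ℝ} (h0 : 0 < e) (h1 : e < 1)
    (hper : ∀ q ∈ ZN β, (q : ℝ) ∈ I → q ∈ purelyPeriodic β)
    (hI : ∀ ε > 0, ∃ a b : ℝ, a < b ∧ Set.Ioo a b ⊆ I ∩ Metric.ball e ε)
    (hacc : ∀ ε > 0, ∃ q ∈ ZN β, q ∉ purelyPeriodic β ∧ |(q : ℝ) - e| < ε) :
    CaseA β e ∨ CaseB β e ∨ CaseC β e := by
  obtain ⟨z, hz, hout⟩ := exists_tile_of_accumulation h0 h1 hacc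
  obtain ⟨a, ha, hmem, hle⟩ := exists_subtile_of_accumulation hper hI hz
  have ha' := dval_eq_iterate_of_mem_nodes ha
  rcases hle.eq_or_lt with he | hlt
  · refine Or.inl ⟨a, ha, ⟨_, ⟨hmem, ⟨e, ?_, rfl⟩, hz⟩, rfl⟩, he.trans ha'.symm⟩
    exact he.trans ha'.symm
  · rw [← ha'] at hlt
    rcases hout with ⟨b, hb, hmemb, hleb⟩ | ⟨x, hx, hmemx⟩
    · rw [← dval_eq_iterate_of_mem_nodes hb] at hleb
      exact Or.inr (Or.inl ⟨a, ha, b, hb,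
        ⟨_, ⟨⟨hmem, hmemb⟩, ⟨e, ⟨hleb, hlt⟩, rfl⟩, hz⟩, rfl⟩, hleb, hlt⟩)
    · exact Or.inr (Or.inr ⟨a, ha, x, hx,
        ⟨_, ⟨⟨hmem, hmemx⟩, ⟨e, ⟨h0, hlt⟩, rfl⟩, hz⟩, rfl⟩, hlt⟩)

/-! ### Approximating endpoints from inside, and consequences of maximality -/

theorem GoodInterval.exists_mem [IsPisot β] {u v : ℝ} (h : GoodInterval β u v) :
    ∃ q : ℚ, 0 ≤ q ∧ q < 1 ∧ u < q ∧ (q : ℝ) < v := by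
  obtain ⟨e, he, h1, h2⟩ := exists_mem_ZN_between (β := β) 0 h.1
  rw [pow_zero, one_mul] at h1 h2
  have hp := h.2 e he ⟨h1, h2⟩
  exact ⟨e, hp.1, hp.2.1, h1, h2⟩

theorem GoodInterval.right_pos [IsPisot β] {u v : ℝ} (h : GoodInterval β u v) : 0 < v := by
  obtain ⟨q, h0, -, -, hv⟩ := h.exists_mem
  exact lt_of_le_of_lt (by exact_mod_cast h0) hv

theorem GoodInterval.left_lt_one [IsPisot β] {u v : ℝ} (h : GoodInterval β u v) : u < 1 := by
  obtain ⟨q, -, h1, hu, -⟩ := h.exists_mem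
  exact hu.trans (by exact_mod_cast h1)

theorem exists_Ioo_subset_right {u v : ℝ} (h : u < v) (ε : ℝ) (hε : 0 < ε) :
    ∃ a b : ℝ, a < b ∧ Set.Ioo a b ⊆ Set.Ioo u v ∩ Metric.ball v ε := by
  refine ⟨max u (v - ε), v, max_lt h (by linarith), fun x hx => ?_⟩
  have h1 := max_lt_iff.1 hx.1
  refine ⟨⟨h1.1, hx.2⟩, ?_⟩
  rw [Metric.mem_ball, Real.dist_eq, abs_lt]
  constructor <;> linarith [hx.2, h1.2]

theorem exists_Ioo_subset_left {u v : ℝ} (h : u < v) (ε : ℝ) (hε : 0 < ε) :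
    ∃ a b : ℝ, a < b ∧ Set.Ioo a b ⊆ Set.Ioo u v ∩ Metric.ball u ε := by
  refine ⟨u, min v (u + ε), lt_min h (by linarith), fun x hx => ?_⟩
  have h1 := lt_min_iff.1 hx.2
  refine ⟨⟨hx.1, h1.1⟩, ?_⟩
  rw [Metric.mem_ball, Real.dist_eq, abs_lt]
  constructor <;> linarith [hx.1, h1.2]

/-- Otherwise the interval could be enlarged to `(u, v + ε)`, against maximality. -/
theorem MaximalInterval.exists_near_right [IsPisot β] {u v : ℝ} (h : MaximalInterval β u v)
    (ε : ℝ) (hε : 0 < ε) : ∃ q ∈ ZN β, q ∉ purelyPeriodic β ∧ |(q : ℝ) - v| < ε := by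
  by_contra! hall
  have hgood : GoodInterval β u (v + ε) := by
    refine ⟨by linarith [h.1.1], fun q hq hqI => ?_⟩
    rcases lt_or_ge (q : ℝ) v with hqv | hqv
    · exact h.1.2 q hq ⟨hqI.1, hqv⟩
    · by_contra hqP
      have h1 := hall q hq hqP
      rw [abs_of_nonneg (by linarith)] at h1
      linarith [hqI.2]
  have heq := h.2 u (v + ε) (Set.Ioo_subset_Ioo_right (by linarith)) hgood
  have hv : v ∈ Set.Ioo u (v + ε) := ⟨h.1.1, by linarith⟩
  rw [heq] at hv
  exact lt_irrefl v hv.2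

theorem MaximalInterval.exists_near_left [IsPisot β] {u v : ℝ} (h : MaximalInterval β u v)
    (ε : ℝ) (hε : 0 < ε) : ∃ q ∈ ZN β, q ∉ purelyPeriodic β ∧ |(q : ℝ) - u| < ε := by
  by_contra! hall
  have hgood : GoodInterval β (u - ε) v := by
    refine ⟨by linarith [h.1.1], fun q hq hqI => ?_⟩
    rcases lt_or_ge u (q : ℝ) with hqu | hqu
    · exact h.1.2 q hq ⟨hqu, hqI.2⟩
    · by_contra hqP
      have h1 := hall q hq hqP
      rw [abs_of_nonpos (by linarith)] at h1
      linarith [hqI.1]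
  have heq := h.2 (u - ε) v (Set.Ioo_subset_Ioo_left (by linarith)) hgood
  have hu : u ∈ Set.Ioo (u - ε) v := ⟨by linarith, h.1.1⟩
  rw [heq] at hu
  exact lt_irrefl u hu.1

end BetaNum

theorem mainTheorem7 (β : ℝ) [BetaNum.IsPisot β] (u v : ℝ)
    (h : BetaNum.GoodInterval β u v) :
    -- the right endpoint
    ((∀ q : ℚ, (q : ℝ) = v → v < 1 → q ∈ BetaNum.ZN β → q ∈ BetaNum.purelyPeriodic β) ∧
      (BetaNum.DensityCondition β →
        ∀ q : ℚ, (q : ℝ) = v → v < 1 → BetaNum.IntegralAtBeta β q →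
          q ∈ BetaNum.purelyPeriodic β) ∧
      (BetaNum.MaximalInterval β u v → v < 1 →
        BetaNum.CaseA β v ∨ BetaNum.CaseB β v ∨ BetaNum.CaseC β v)) ∧
    -- the left endpoint
    ((∀ q : ℚ, (q : ℝ) = u → 0 < u → q ∈ BetaNum.ZN β → q ∈ BetaNum.purelyPeriodic β) ∧
      (BetaNum.DensityCondition β →
        ∀ q : ℚ, (q : ℝ) = u → 0 < u → BetaNum.IntegralAtBeta β q →
          q ∈ BetaNum.purelyPeriodic β) ∧
      (BetaNum.MaximalInterval β u v → 0 < u →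
        BetaNum.CaseA β u ∨ BetaNum.CaseB β u ∨ BetaNum.CaseC β u)) := by
  have hright : ∀ q : ℚ, (q : ℝ) = v → v < 1 → q ∈ BetaNum.ZN β →
      q ∈ BetaNum.purelyPeriodic β := by
    rintro q rfl hv hq
    exact BetaNum.purelyPeriodic_of_accumulation (by exact_mod_cast h.right_pos)
      (by exact_mod_cast hv) hq h.2 (BetaNum.exists_Ioo_subset_right h.1)
  have hleft : ∀ q : ℚ, (q : ℝ) = u → 0 < u → q ∈ BetaNum.ZN β →
      q ∈ BetaNum.purelyPeriodic β := by
    rintro q rfl hu hq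
    exact BetaNum.purelyPeriodic_of_accumulation (by exact_mod_cast hu)
      (by exact_mod_cast h.left_lt_one) hq h.2 (BetaNum.exists_Ioo_subset_left h.1)
  refine ⟨⟨hright, fun _ q hqv hv hq => hright q hqv hv (BetaNum.mem_ZN_of_integralAtBeta hq),
    fun hmax hv => ?_⟩, hleft,
    fun _ q hqu hu hq => hleft q hqu hu (BetaNum.mem_ZN_of_integralAtBeta hq),
    fun hmax hu => ?_⟩
  · exact BetaNum.cases_of_accumulation h.right_pos hv h.2
      (BetaNum.exists_Ioo_subset_right h.1) hmax.exists_near_right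
  · exact BetaNum.cases_of_accumulation hu h.left_lt_one h.2
      (BetaNum.exists_Ioo_subset_left h.1) hmax.exists_near_left
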